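/- There is a constant $c\ge 0$ with the following two properties. (1) For every $m\ge 2$ and every set of $m$ congruent closed disks of positive radius in the plane with pairwise disjoint interiors, there is a line $\ell$ such that each of the two open half-planes bounded by $\ell$ completely contains at least $m/2-c\sqrt{m\log_2 m}$ of the disks. (2) Such a line can be found in $O(m)$ expected time: there are a randomized algorithm and a constant $C$ such that for every $m\ge 2$ and every such set of $m$ disks, given as $m$, the coordinates of the centers and the common radius, the algorithm terminates with probability one, whenever it terminates it outputs the coefficients of a line with the property in (1) (for the same constant $c$), and its expected number of steps is at most $C\,m$. The algorithm is a fixed program on a unit-cost real RAM with indirect addressing, with the operations $+,-$ on nonnegative integers (subtraction truncated at $0$), $+,-,\times,\div$ on reals, conversion of integers to reals, comparisons, and the drawing of a uniformly random integer from $\{0,\dots,k\}$ for a computed integer $k$. -/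

import Mathlib

/-! ## A randomized real RAM

The memory consists of integer arrays (nonnegative integers) and real arrays; each array is
addressed by an integer computed at run time (indirect addressing).  Programs are finite while-programs.
The arithmetic is `+` and truncated `-` on integers, `+`, `-`, `*`, `/` on reals, and comparisons;
there is no rounding of reals, no integer multiplication and no root.  The only source of randomness
is the draw of a uniformly random integer from `{0, …, k}`. -/

namespace RealRAM

/-- The memory: `nat a i` is cell `i` of the integer array `a`, `real a i` is cell `i` of the
real array `a`. -/
structure Store where
  nat : ℕ → ℕ → ℕ
  real : ℕ → ℕ → ℝ

/-- Write `v` into cell `i` of the integer array `a`. -/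
def Store.setNat (s : Store) (a i v : ℕ) : Store :=
  { s with nat := Function.update s.nat a (Function.update (s.nat a) i v) }

/-- Write `v` into cell `i` of the real array `a`. -/
noncomputable def Store.setReal (s : Store) (a i : ℕ) (v : ℝ) : Store :=
  { s with real := Function.update s.real a (Function.update (s.real a) i v) }

/-- Integer expressions; `cell a e` reads the cell of array `a` whose index is the value of `e`. -/
inductive NExpr where
  | const (k : ℕ)
  | cell (a : ℕ) (e : NExpr)
  | add (e f : NExpr)
  | sub (e f : NExpr)

/-- Value of an integer expression (subtraction is truncated at `0`). -/
def NExpr.eval (s : Store) : NExpr → ℕ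
  | const k => k
  | cell a e => s.nat a (e.eval s)
  | add e f => e.eval s + f.eval s
  | sub e f => e.eval s - f.eval s

/-- Real expressions; constants are rational, and an integer can be converted to a real. -/
inductive RExpr where
  | const (q : ℚ)
  | ofNat (e : NExpr)
  | cell (a : ℕ) (e : NExpr)
  | add (e f : RExpr)
  | sub (e f : RExpr)
  | mul (e f : RExpr)
  | div (e f : RExpr)

/-- Value of a real expression (a division by `0` returns `0`). -/
noncomputable def RExpr.eval (s : Store) : RExpr → ℝ
  | const q => (q : ℝ)
  | ofNat e => (e.eval s : ℝ)
  | cell a e => s.real a (e.eval s)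
  | add e f => e.eval s + f.eval s
  | sub e f => e.eval s - f.eval s
  | mul e f => e.eval s * f.eval s
  | div e f => e.eval s / f.eval s

/-- Tests. -/
inductive Test where
  | natLt (e f : NExpr)
  | realLt (e f : RExpr)
  | not (b : Test)
  | and (b c : Test)

/-- Truth of a test in a store. -/
def Test.Holds (s : Store) : Test → Prop
  | natLt e f => e.eval s < f.eval s
  | realLt e f => e.eval s < f.eval s
  | not b => ¬ b.Holds s
  | and b c => b.Holds s ∧ c.Holds s

/-- Programs.  `setNat a i e` and `setReal a i e` write the value of `e` into cell `i` of array
`a`; `rand a i e` writes a uniformly random element of `{0, …, k}` there, `k` being the value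
of `e`. -/
inductive Program where
  | setNat (a : ℕ) (i : NExpr) (e : NExpr)
  | setReal (a : ℕ) (i : NExpr) (e : RExpr)
  | rand (a : ℕ) (i : NExpr) (e : NExpr)
  | seq (p q : Program)
  | ite (b : Test) (p q : Program)
  | whileDo (b : Test) (p : Program)

/-- A configuration: the stack of programs that are still to be executed, and the memory. -/
structure Config where
  todo : List Program
  store : Store

/-- The computation has ended. -/
def Config.Halted (c : Config) : Prop := c.todo = []

open Classical in
/-- One step, as a probability distribution on the next configuration.  Every step has unit cost;
all expressions that occur in a fixed program have constant size. -/
noncomputable def Config.step : Config → PMF Config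
  | ⟨[], s⟩ => PMF.pure ⟨[], s⟩
  | ⟨.setNat a i e :: κ, s⟩ => PMF.pure ⟨κ, s.setNat a (i.eval s) (e.eval s)⟩
  | ⟨.setReal a i e :: κ, s⟩ => PMF.pure ⟨κ, s.setReal a (i.eval s) (e.eval s)⟩
  | ⟨.rand a i e :: κ, s⟩ =>
      (PMF.uniformOfFintype (Fin (e.eval s + 1))).map
        fun z => ⟨κ, s.setNat a (i.eval s) (z : ℕ)⟩
  | ⟨.seq p q :: κ, s⟩ => PMF.pure ⟨p :: q :: κ, s⟩
  | ⟨.ite b p q :: κ, s⟩ => PMF.pure ⟨(if b.Holds s then p else q) :: κ, s⟩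
  | ⟨.whileDo b p :: κ, s⟩ =>
      PMF.pure ⟨if b.Holds s then p :: .whileDo b p :: κ else κ, s⟩

/-- Distribution of the configuration after `n` steps. -/
noncomputable def Config.run : ℕ → Config → PMF Config
  | 0, c => PMF.pure c
  | n + 1, c => c.step.bind (Config.run n)

/-- The expected number of steps until the computation ends,
`E[T] = ∑_{n ≥ 0} P(T > n)`; it is `∞` if the computation fails to end with positive
probability. -/
noncomputable def Config.expectedTime (c : Config) : ENNReal :=
  ∑' n : ℕ, (c.run n).toOuterMeasure {d | ¬ d.Halted}

/-- Whenever the computation ends, whatever the random choices, the final memory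
satisfies `Q`. -/
def Config.AlwaysReturns (c : Config) (Q : Store → Prop) : Prop :=
  ∀ n : ℕ, ∀ d ∈ (c.run n).support, d.Halted → Q d.store

end RealRAM

/-! ## Congruent nonoverlapping disks and lines -/

/-- The Euclidean plane. -/
abbrev Plane : Type := EuclideanSpace ℝ (Fin 2)

/-- A family of `m` congruent disks in the plane with pairwise disjoint interiors. -/
structure DiskFamily (m : ℕ) where
  center : Fin m → Plane
  radius : ℝ
  radius_pos : 0 < radius
  nonoverlapping : Pairwise fun i j =>
    Disjoint (interior (Metric.closedBall (center i) radius))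
      (interior (Metric.closedBall (center j) radius))

/-- The `i`-th disk (closed). -/
def DiskFamily.disk {m : ℕ} (D : DiskFamily m) (i : Fin m) : Set Plane :=
  Metric.closedBall (D.center i) D.radius

/-- One of the two open sides of the line `a x + b y = c`. -/
def negSide (a b c : ℝ) : Set Plane := {x | a * x 0 + b * x 1 < c}

/-- The other open side of the line `a x + b y = c`. -/
def posSide (a b c : ℝ) : Set Plane := {x | c < a * x 0 + b * x 1}

/-- `a x + b y = c` is the equation of a line that has at least `m / 2 - κ √(m log₂ m)` of the
`m` disks completely on each side. -/
def DiskFamily.IsSeparator {m : ℕ} (D : DiskFamily m) (κ a b c : ℝ) : Prop :=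
  (a ≠ 0 ∨ b ≠ 0) ∧
  (m : ℝ) / 2 - κ * √((m : ℝ) * Real.logb 2 (m : ℝ)) ≤
    ({i | D.disk i ⊆ negSide a b c}.ncard : ℝ) ∧
  (m : ℝ) / 2 - κ * √((m : ℝ) * Real.logb 2 (m : ℝ)) ≤
    ({i | D.disk i ⊆ posSide a b c}.ncard : ℝ)

/-- The input of the machine: the number of disks is in cell `0` of integer array `0`, the
coordinates of the centers are in real arrays `0` and `1`, and the common radius is in cell `0` of
real array `2`; all other cells are `0`. -/
noncomputable def DiskFamily.input {m : ℕ} (D : DiskFamily m) : RealRAM.Store where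
  nat a i := if a = 0 ∧ i = 0 then m else 0
  real a i :=
    if h : i < m ∧ a = 0 then D.center ⟨i, h.1⟩ 0
    else if h : i < m ∧ a = 1 then D.center ⟨i, h.1⟩ 1
    else if a = 2 ∧ i = 0 then D.radius
    else 0

/-! Only the `m + 1` normal directions `(m, j)`, `0 ≤ j ≤ m`, are considered, each with a line
through a median of the projected centers. The disks crossing a line have their centers in a strip
of width proportional to the radius `r`. Two strips with normals `(m, j)` and `(m, l)` meet in a
parallelogram of area `O(r² m / |j - l|)`, so only `O(m / |j - l|)` disjoint disks can cross both
lines (`DiskFamily.card_crossing_inter_le`). Cauchy–Schwarz over the disks (`sq_sum_card_le`) turns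
this into a bound on the set of bad directions, those with more than `√(650 m H_m)` crossing disks,
where `H_m` is the harmonic sum: at most `m / 2` of them exist (`DiskFamily.two_mul_card_le`). For a
good direction each side of the median line completely contains at least `m / 2` minus the number of
crossing disks, and `H_m ≤ 2 log₂ m`.

The algorithm draws `j` at random, finds the median by randomized quickselect, counts the crossing
disks and starts again if there are too many. The threshold uses `H_m`, which field operations can
compute, instead of a logarithm. The acceptance test certifies the answer, so only the running time
is random; an attempt has expected cost `O(m)` and fails with probability below one half.

Running time and correctness are proved together: `Config.cost` is the expected number of steps
truncated at `n`, and is infinite when a wrong output is seen within that horizon. A finite bound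
uniform in `n` gives both conclusions, and induction on `n` handles loops whose number of rounds is
unbounded. -/

namespace RealRAM

/-! ### Truncated expected cost, and rules for bounding it -/

theorem tsum_bind_mul {α β : Type*} (p : PMF α) (h : α → PMF β) (f : β → ENNReal) :
    ∑' d, (p.bind h) d * f d = ∑' a, p a * ∑' d, h a d * f d := by
  simp only [PMF.bind_apply, ← ENNReal.tsum_mul_right, ← ENNReal.tsum_mul_left]
  rw [ENNReal.tsum_comm]
  simp only [mul_assoc]

theorem tsum_pure_mul {α : Type*} (a : α) (f : α → ENNReal) :
    ∑' d, (PMF.pure a) d * f d = f a := by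
  rw [tsum_eq_single a]
  · simp [PMF.pure_apply]
  · intro b hb
    simp [PMF.pure_apply, hb]

theorem tsum_map_mul {α β : Type*} (p : PMF α) (g : α → β) (f : β → ENNReal) :
    ∑' d, (p.map g) d * f d = ∑' a, p a * f (g a) := by
  rw [PMF.map, tsum_bind_mul]
  simp

open Classical in
/-- The expected number of steps among the first `n`, with value `⊤` as soon as a computation
that violates the postcondition `Q` is possible. -/
noncomputable def Config.cost (Q : Store → Prop) : ℕ → Config → ENNReal
  | 0, _ => 0
  | n + 1, c => if c.Halted then (if Q c.store then 0 else ⊤)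
      else 1 + ∑' d, c.step d * Config.cost Q n d

open Config

theorem cost_succ_of_halted {Q : Store → Prop} {n : ℕ} {s : Store} (h : Q s) :
    cost Q (n + 1) ⟨[], s⟩ = 0 := by
  simp [cost, Halted, h]

theorem cost_nil_le {Q : Store → Prop} {n : ℕ} {s : Store} (h : Q s) :
    cost Q n ⟨[], s⟩ ≤ 0 := by
  cases n with
  | zero => simp [cost]
  | succ n => rw [cost_succ_of_halted h]

theorem cost_succ_of_not_halted {Q : Store → Prop} {n : ℕ} {c : Config} (h : ¬ c.Halted) :
    cost Q (n + 1) c = 1 + ∑' d, c.step d * cost Q n d := by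
  rw [cost, if_neg h]

/-- Monotonicity in the horizon lets every later rule keep the same `n` on both sides instead of
counting down the exact number of steps used. -/
theorem cost_le_succ (Q : Store → Prop) (n : ℕ) (c : Config) : cost Q n c ≤ cost Q (n + 1) c := by
  induction n generalizing c with
  | zero => simp [cost]
  | succ n ih =>
    by_cases h : c.Halted
    · simp [cost, h]
    · rw [cost_succ_of_not_halted h, cost_succ_of_not_halted h]
      gcongr
      exact ih _

theorem run_of_halted {c : Config} (h : c.Halted) (n : ℕ) : c.run n = PMF.pure c := by
  obtain ⟨l, s⟩ := c
  obtain rfl : l = [] := h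
  induction n with
  | zero => rfl
  | succ n ih => rw [run]; simp [step, ih]

/-- The tail-sum formula for the expected halting time, truncated at `n`; a violation of `Q` can
only increase the right side. -/
theorem sum_not_halted_le_cost (Q : Store → Prop) (n : ℕ) (c : Config) :
    ∑ k ∈ Finset.range n, (c.run k).toOuterMeasure {d | ¬ d.Halted} ≤ cost Q n c := by
  induction n generalizing c with
  | zero => simp
  | succ n ih =>
    by_cases h : c.Halted
    · simp [run_of_halted h, PMF.toOuterMeasure_pure_apply, h]
    · rw [cost_succ_of_not_halted h, Finset.sum_range_succ', add_comm]
      gcongr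
      · simp [run, PMF.toOuterMeasure_pure_apply, h]
      · simp only [run, PMF.toOuterMeasure_bind_apply]
        rw [← Summable.tsum_finsetSum (fun _ _ => ENNReal.summable)]
        refine ENNReal.tsum_le_tsum fun d => ?_
        rw [← Finset.mul_sum]
        gcongr
        exact ih d

theorem expectedTime_le {Q : Store → Prop} {c : Config} {b : ENNReal}
    (h : ∀ n, cost Q n c ≤ b) : c.expectedTime ≤ b := by
  rw [expectedTime, ENNReal.tsum_eq_iSup_nat]
  exact iSup_le fun n => (sum_not_halted_le_cost Q n c).trans (h n)

/-- A violating configuration reached with positive probability contributes a positive number times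
`⊤`. The index is `n + 1` because `cost` inspects a halted configuration only when its horizon is
positive. -/
theorem holds_of_cost_ne_top {Q : Store → Prop} (n : ℕ) (c : Config)
    (h : cost Q (n + 1) c ≠ ⊤) : ∀ d ∈ (c.run n).support, d.Halted → Q d.store := by
  induction n generalizing c with
  | zero =>
    intro d hd hh
    obtain rfl : d = c := by simpa [run] using hd
    by_contra hq
    exact h (by simp [cost, hh, hq])
  | succ n ih =>
    intro d hd hh
    rw [run, PMF.mem_support_bind_iff] at hd
    obtain ⟨e, he, hd⟩ := hd
    by_cases hc : c.Halted
    · have h1 : d = c := by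
        have : d ∈ (c.run (n + 1)).support := by
          rw [run, PMF.mem_support_bind_iff]; exact ⟨e, he, hd⟩
        simpa [run_of_halted hc] using this
      subst h1
      by_contra hq
      exact h (by simp [cost, hh, hq])
    · refine ih e (fun htop => h ?_) d hd hh
      rw [cost_succ_of_not_halted hc]
      have : ∑' d, c.step d * cost Q (n + 1) d = ⊤ := by
        refine ENNReal.tsum_eq_top_of_eq_top ⟨e, ?_⟩
        rw [htop]
        exact ENNReal.mul_top ((PMF.mem_support_iff _ _).1 he)
      simp [this]

theorem alwaysReturns_of_cost_le {Q : Store → Prop} {c : Config} {b : ℕ}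
    (h : ∀ n, cost Q n c ≤ b) : c.AlwaysReturns Q := fun n =>
  holds_of_cost_ne_top n c (ne_top_of_le_ne_top (ENNReal.natCast_ne_top b) (h _))

/-- Program `p` takes the store `s` deterministically to the store `s'` in at most `k` steps. -/
def Runs (p : Program) (k : ℕ) (s s' : Store) : Prop :=
  ∀ (Q : Store → Prop) (n : ℕ) (κ : List Program),
    cost Q n ⟨p :: κ, s⟩ ≤ k + cost Q n ⟨κ, s'⟩

theorem cost_le_of_step_eq_pure {Q : Store → Prop} {c d : Config} (h : ¬ c.Halted)
    (hs : c.step = PMF.pure d) (n : ℕ) : cost Q n c ≤ 1 + cost Q n d := by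
  cases n with
  | zero => simp [cost]
  | succ n =>
    rw [cost_succ_of_not_halted h, hs, tsum_pure_mul]
    gcongr
    exact cost_le_succ _ _ _

theorem Runs.mono {p : Program} {k l : ℕ} {s s' : Store} (h : Runs p k s s') (hk : k ≤ l) :
    Runs p l s s' := fun Q n κ => (h Q n κ).trans (by gcongr)

theorem Runs.setNat (a : ℕ) (i e : NExpr) (s : Store) :
    Runs (.setNat a i e) 1 s (s.setNat a (i.eval s) (e.eval s)) := fun Q n κ => by
  simpa using cost_le_of_step_eq_pure (Q := Q) (c := ⟨.setNat a i e :: κ, s⟩)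
    (by simp [Halted]) (by rw [step]) n

theorem Runs.setReal (a : ℕ) (i : NExpr) (e : RExpr) (s : Store) :
    Runs (.setReal a i e) 1 s (s.setReal a (i.eval s) (e.eval s)) := fun Q n κ => by
  simpa using cost_le_of_step_eq_pure (Q := Q) (c := ⟨.setReal a i e :: κ, s⟩)
    (by simp [Halted]) (by rw [step]) n

theorem cost_seq_le (Q : Store → Prop) (n : ℕ) (p q : Program) (κ : List Program) (s : Store) :
    cost Q n ⟨.seq p q :: κ, s⟩ ≤ 1 + cost Q n ⟨p :: q :: κ, s⟩ :=
  cost_le_of_step_eq_pure (by simp [Halted]) (by rw [step]) n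

theorem Runs.seq {p q : Program} {k l : ℕ} {s s' s'' : Store} (hp : Runs p k s s')
    (hq : Runs q l s' s'') : Runs (.seq p q) (1 + k + l) s s'' := fun Q n κ => by
  refine (cost_seq_le Q n p q κ s).trans ?_
  push_cast
  rw [add_assoc, add_assoc]
  gcongr
  refine (hp Q n _).trans ?_
  gcongr
  exact hq Q n _

theorem Runs.ite_pos {b : Test} {p q : Program} {k : ℕ} {s s' : Store} (hb : b.Holds s)
    (hp : Runs p k s s') : Runs (.ite b p q) (1 + k) s s' := fun Q n κ => by
  refine (cost_le_of_step_eq_pure (d := ⟨p :: κ, s⟩) (by simp [Halted])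
    (by simp [step, hb]) n).trans ?_
  push_cast
  rw [add_assoc]
  gcongr
  exact hp Q n _

theorem Runs.ite_neg {b : Test} {p q : Program} {k : ℕ} {s s' : Store} (hb : ¬ b.Holds s)
    (hq : Runs q k s s') : Runs (.ite b p q) (1 + k) s s' := fun Q n κ => by
  refine (cost_le_of_step_eq_pure (d := ⟨q :: κ, s⟩) (by simp [Halted])
    (by simp [step, hb]) n).trans ?_
  push_cast
  rw [add_assoc]
  gcongr
  exact hq Q n _

theorem Runs.while_neg {b : Test} {p : Program} {s : Store} (hb : ¬ b.Holds s) :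
    Runs (.whileDo b p) 1 s s := fun Q n κ => by
  simpa using cost_le_of_step_eq_pure (Q := Q) (c := ⟨.whileDo b p :: κ, s⟩) (d := ⟨κ, s⟩)
    (by simp [Halted]) (by simp [step, hb]) n

theorem cost_succ_while {Q : Store → Prop} {n : ℕ} {b : Test} {p : Program} {κ : List Program}
    {s : Store} (hb : b.Holds s) :
    cost Q (n + 1) ⟨.whileDo b p :: κ, s⟩ = 1 + cost Q n ⟨p :: .whileDo b p :: κ, s⟩ := by
  rw [cost_succ_of_not_halted (by simp [Halted])]
  simp [step, hb]

theorem Runs.while_pos {b : Test} {p : Program} {k l : ℕ} {s s' s'' : Store} (hb : b.Holds s)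
    (hp : Runs p k s s') (hw : Runs (.whileDo b p) l s' s'') :
    Runs (.whileDo b p) (1 + k + l) s s'' := fun Q n κ => by
  refine (cost_le_of_step_eq_pure (d := ⟨p :: .whileDo b p :: κ, s⟩) (by simp [Halted])
    (by simp [step, hb]) n).trans ?_
  push_cast
  rw [add_assoc, add_assoc]
  gcongr
  refine (hp Q n _).trans ?_
  gcongr
  exact hw Q n _

theorem Runs.while_of_invariant {b : Test} {p : Program} {k N : ℕ} (I : ℕ → Store → Prop)
    (hstep : ∀ t < N, ∀ s, I t s → b.Holds s ∧ ∃ s', Runs p k s s' ∧ I (t + 1) s')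
    (hend : ∀ s, I N s → ¬ b.Holds s) {s : Store} (hs : I 0 s) :
    ∃ s', Runs (.whileDo b p) (N * (k + 1) + 1) s s' ∧ I N s' := by
  suffices h : ∀ r t, t + r = N → ∀ s, I t s →
      ∃ s', Runs (.whileDo b p) (r * (k + 1) + 1) s s' ∧ I N s' from h N 0 (by simp) s hs
  intro r
  induction r with
  | zero =>
    intro t ht s hs
    obtain rfl : t = N := by simpa using ht
    exact ⟨s, (Runs.while_neg (hend s hs)).mono (by simp), hs⟩
  | succ r ih =>
    intro t ht s hs
    obtain ⟨hb, s', hr, hs'⟩ := hstep t (by omega) s hs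
    obtain ⟨s'', hr', hs''⟩ := ih (t + 1) (by omega) s' hs'
    refine ⟨s'', (Runs.while_pos hb hr hr').mono ?_, hs''⟩
    rw [Nat.succ_mul]
    omega

/-- The only rule that averages. The mean of the bounds `f z` is compared with `y` after clearing
the denominator `k + 1`, so that callers can stay in `ℕ`. -/
theorem cost_rand_le {Q : Store → Prop} {n : ℕ} {a : ℕ} {i e : NExpr} {κ : List Program}
    {s : Store} {k : ℕ} (hk : e.eval s = k) (f : ℕ → ℕ) (y : ℕ)
    (hf : ∀ z ≤ k, cost Q n ⟨κ, s.setNat a (i.eval s) z⟩ ≤ f z)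
    (hy : ∑ z ∈ Finset.range (k + 1), f z ≤ (k + 1) * y) :
    cost Q n ⟨.rand a i e :: κ, s⟩ ≤ (1 + y : ℕ) := by
  subst hk
  cases n with
  | zero => simp [cost]
  | succ n =>
    rw [cost_succ_of_not_halted (by simp [Halted]), step, tsum_map_mul]
    push_cast
    gcongr
    -- The law of the drawn number is the image in `ℕ` of the uniform law on `Fin`.
    change ∑' z, ((PMF.uniformOfFintype (Fin (e.eval s + 1))).bind fun x => PMF.pure (x : ℕ)) z *
      cost Q n ⟨κ, s.setNat a (i.eval s) z⟩ ≤ _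
    rw [tsum_bind_mul, tsum_fintype]
    simp only [tsum_pure_mul, PMF.uniformOfFintype_apply, Fintype.card_fin, ← Finset.mul_sum]
    rw [← ENNReal.div_eq_inv_mul]
    refine ENNReal.div_le_of_le_mul ?_
    calc _ ≤ ∑ z : Fin (e.eval s + 1), ((f z : ℕ) : ENNReal) :=
          Finset.sum_le_sum fun z _ =>
            (cost_le_succ _ _ _).trans (hf z (Nat.lt_succ_iff.1 z.2))
      _ = ((∑ z ∈ Finset.range (e.eval s + 1), f z : ℕ) : ENNReal) := by
          rw [Finset.sum_range]; push_cast; rfl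
      _ ≤ (((e.eval s + 1) * y : ℕ) : ENNReal) := by exact_mod_cast hy
      _ = _ := by push_cast; ring

end RealRAM

/-! ### Disks that cross two lines -/

theorem DiskFamily.two_mul_radius_le_dist {m : ℕ} (D : DiskFamily m) {i j : Fin m} (h : i ≠ j) :
    2 * D.radius ≤ dist (D.center i) (D.center j) := by
  by_contra hlt
  push Not at hlt
  have hd : Disjoint (interior (Metric.closedBall (D.center i) D.radius))
      (interior (Metric.closedBall (D.center j) D.radius)) := D.nonoverlapping h
  rw [interior_closedBall _ D.radius_pos.ne', interior_closedBall _ D.radius_pos.ne'] at hd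
  refine Set.disjoint_left.1 hd
    (?_ : midpoint ℝ (D.center i) (D.center j) ∈ Metric.ball (D.center i) D.radius) ?_
  · rw [Metric.mem_ball, dist_midpoint_left]
    norm_num
    linarith
  · rw [Metric.mem_ball, dist_midpoint_right]
    norm_num
    linarith

theorem DiskFamily.four_mul_sq_radius_le {m : ℕ} (D : DiskFamily m) {i j : Fin m} (h : i ≠ j) :
    4 * D.radius ^ 2 ≤ (D.center i 0 - D.center j 0) ^ 2 + (D.center i 1 - D.center j 1) ^ 2 := by
  have h1 := D.two_mul_radius_le_dist h
  rw [EuclideanSpace.dist_eq, Fin.sum_univ_two, Real.dist_eq, Real.dist_eq, sq_abs, sq_abs] at h1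
  have := Real.le_sqrt' (by linarith [D.radius_pos]) |>.1 h1
  linarith

/-- The value at the `i`-th center of the linear form `a x + b y`. -/
noncomputable def DiskFamily.form {m : ℕ} (D : DiskFamily m) (a b : ℝ) (i : Fin m) : ℝ :=
  a * D.center i 0 + b * D.center i 1

/-- The disks that are not completely on one side of the line `a x + b y = c`. -/
noncomputable def DiskFamily.crossing {m : ℕ} (D : DiskFamily m) (a b c : ℝ) : Finset (Fin m) :=
  Finset.univ.filter fun i => ¬ D.radius ^ 2 * (a ^ 2 + b ^ 2) < (D.form a b i - c) ^ 2

theorem DiskFamily.abs_form_sub_le {m : ℕ} (D : DiskFamily m) {j : ℕ} (hj : j ≤ m) {c : ℝ}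
    {i : Fin m} (hi : i ∈ D.crossing m j c) : |D.form m j i - c| ≤ 2 * D.radius * m := by
  simp only [crossing, Finset.mem_filter, Finset.mem_univ, true_and, not_lt] at hi
  have hj' : (j : ℝ) ≤ m := by exact_mod_cast hj
  have hr := D.radius_pos
  refine abs_le_of_sq_le_sq (hi.trans ?_) (by positivity)
  have : (j : ℝ) ^ 2 ≤ (m : ℝ) ^ 2 := by gcongr
  nlinarith [sq_nonneg (D.radius), mul_nonneg (sq_nonneg D.radius) (sq_nonneg (m : ℝ)),
    mul_le_mul_of_nonneg_left this (sq_nonneg D.radius)]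

theorem Int.floor_mem_Icc_of_abs_sub_le {x c w : ℝ} {n : ℕ} (h : |x - c| ≤ w) (hn : 2 * w ≤ n) :
    ⌊x⌋ ∈ Finset.Icc ⌊c - w⌋ (⌊c - w⌋ + n) := by
  rw [abs_le] at h
  rw [Finset.mem_Icc]
  constructor
  · exact Int.floor_le_floor (by linarith)
  · rw [← Int.floor_add_natCast]
    exact Int.floor_le_floor (by linarith)

theorem abs_sub_lt_one_of_floor_eq {x y : ℝ} (h : ⌊x⌋ = ⌊y⌋) : |x - y| < 1 :=
  Int.abs_sub_lt_one_of_floor_eq_floor h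

/-- A packing argument in sheared coordinates: the parallelogram common to both strips is covered by
grid cells, and each cell is too small for two centers. -/
theorem DiskFamily.card_crossing_inter_le {m : ℕ} (hm : 0 < m) (D : DiskFamily m) {j l : ℕ}
    (hj : j ≤ m) (hl : l < j) (c d : ℝ) :
    ((D.crossing m j c ∩ D.crossing m l d).card : ℝ) ≤ 162 * m / (j - l) := by
  have hr := D.radius_pos
  have hm' : (0 : ℝ) < m := by exact_mod_cast hm
  have hjl : (0 : ℝ) < (j : ℝ) - l := by
    have : (l : ℝ) < j := by exact_mod_cast hl
    linarith
  -- The coordinates `x + (j / m) y` and `y`, in units of half a radius.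
  set X : Fin m → ℝ := fun i => 2 * D.form m j i / (m * D.radius) with hX
  set Y : Fin m → ℝ := fun i => 2 * D.center i 1 / D.radius with hY
  set n : ℕ := ⌈(16 : ℝ) * m / (j - l)⌉₊ with hn
  set A := Finset.Icc ⌊2 * c / (m * D.radius) - 4⌋ (⌊2 * c / (m * D.radius) - 4⌋ + (8 : ℕ))
    with hA
  set B := Finset.Icc ⌊2 * (c - d) / ((j - l) * D.radius) - 8 * m / (j - l)⌋
    (⌊2 * (c - d) / ((j - l) * D.radius) - 8 * m / (j - l)⌋ + n) with hB
  have hmaps : ∀ i ∈ D.crossing m j c ∩ D.crossing m l d,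
      (⌊X i⌋, ⌊Y i⌋) ∈ A ×ˢ B := by
    intro i hi
    rw [Finset.mem_inter] at hi
    have h1 := D.abs_form_sub_le hj hi.1
    have h2 := D.abs_form_sub_le (hl.le.trans hj) hi.2
    rw [Finset.mem_product]
    refine ⟨Int.floor_mem_Icc_of_abs_sub_le ?_ (by norm_num), Int.floor_mem_Icc_of_abs_sub_le ?_ ?_⟩
    · have : X i - 2 * c / (m * D.radius) = (D.form m j i - c) * (2 / (m * D.radius)) := by
        simp only [hX]; ring
      rw [this, abs_mul, abs_of_pos (a := 2 / (m * D.radius)) (by positivity)]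
      calc _ ≤ 2 * D.radius * m * (2 / (m * D.radius)) := by gcongr
        _ = 4 := by field_simp; norm_num
    -- The difference of the two forms is `(j - l) y`, so the two strips together confine `y`.
    · have : Y i - 2 * (c - d) / ((j - l) * D.radius) =
          ((D.form m j i - c) - (D.form m l i - d)) * (2 / ((j - l) * D.radius)) := by
        simp only [hY, form]; field_simp; ring
      rw [this, abs_mul, abs_of_pos (a := 2 / (((j : ℝ) - l) * D.radius)) (by positivity)]
      calc _ ≤ (2 * D.radius * m + 2 * D.radius * m) * (2 / ((j - l) * D.radius)) := by
            gcongr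
            exact (abs_sub _ _).trans (add_le_add h1 h2)
        _ = 8 * m / (j - l) := by field_simp; norm_num
    · refine le_trans (le_of_eq ?_) (Nat.le_ceil _)
      ring
  have hinj : Set.InjOn (fun i => (⌊X i⌋, ⌊Y i⌋))
      (D.crossing m j c ∩ D.crossing m l d : Finset (Fin m)) := by
    intro i _ i' _ h
    by_contra hne
    rw [Prod.mk.injEq] at h
    have h1 := abs_sub_lt_one_of_floor_eq h.1
    have h2 := abs_sub_lt_one_of_floor_eq h.2
    have h3 := D.four_mul_sq_radius_le hne
    set dx := D.center i 0 - D.center i' 0 with hdx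
    set dy := D.center i 1 - D.center i' 1 with hdy
    have e1 : X i - X i' = 2 / D.radius * (dx + j / m * dy) := by
      simp only [hX, form, hdx, hdy]; field_simp; ring
    have e2 : Y i - Y i' = 2 / D.radius * dy := by
      simp only [hY, hdy]; field_simp
    have h2r : 0 < 2 / D.radius := by positivity
    have key : ∀ z : ℝ, |2 / D.radius * z| < 1 → |z| < D.radius / 2 := by
      intro z hz
      rw [abs_mul, abs_of_pos h2r] at hz
      rw [div_mul_eq_mul_div, div_lt_one hr] at hz
      linarith
    rw [e1] at h1
    rw [e2] at h2
    have k1 := key _ h1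
    have k2 := key _ h2
    -- Since `j ≤ m` the shear is mild: both coordinate differences stay below `r`, hence the
    -- distance below `2 r`.
    have k3 : |(j : ℝ) / m * dy| ≤ |dy| := by
      rw [abs_mul, abs_of_nonneg (by positivity : (0 : ℝ) ≤ j / m)]
      refine mul_le_of_le_one_left (abs_nonneg _) ?_
      rw [div_le_one hm']
      exact_mod_cast hj
    have k4 : |dx| < D.radius := by
      have : dx = (dx + j / m * dy) - j / m * dy := by ring
      rw [this]
      refine (abs_sub _ _).trans_lt ?_
      linarith
    have k5 := sq_lt_sq' (neg_lt_of_abs_lt k4) (lt_of_abs_lt k4)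
    have k6 := sq_lt_sq' (neg_lt_of_abs_lt k2) (lt_of_abs_lt k2)
    nlinarith
  have hcard := Finset.card_le_card_of_injOn _ hmaps hinj
  -- This absorbs the rounding in `n` and the extra endpoint: `n + 1 ≤ 18 m / (j - l)`, and there
  -- are 9 columns, whence 162.
  have hq : (1 : ℝ) ≤ m / (j - l) := by
    rw [le_div_iff₀ hjl]
    have : (j : ℝ) ≤ m := by exact_mod_cast hj
    have : (0 : ℝ) ≤ l := by positivity
    linarith
  have hn2 : (n : ℝ) < 16 * m / (j - l) + 1 := Nat.ceil_lt_add_one (by positivity)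
  have hc : ((A ×ˢ B).card : ℝ) = 9 * (n + 1) := by
    rw [Finset.card_product, hA, hB, Int.card_Icc, Int.card_Icc]
    have e1 : ∀ z : ℤ, ∀ q : ℕ, (z + (q : ℤ) + 1 - z).toNat = q + 1 := by
      intro z q; omega
    rw [e1, e1]
    push_cast
    norm_num
  calc ((D.crossing m j c ∩ D.crossing m l d).card : ℝ) ≤ ((A ×ˢ B).card : ℝ) := by
        exact_mod_cast hcard
    _ = 9 * (n + 1) := hc
    _ ≤ 9 * (16 * (m / (j - l)) + 2 * (m / (j - l))) := by
        have : (16 : ℝ) * m / (j - l) = 16 * (m / (j - l)) := by ring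
        linarith
    _ = 162 * m / (j - l) := by ring

/-! ### Harmonic sums and the number of bad directions -/

/-- The sum `1 + 1/2 + ⋯ + 1/m`. -/
noncomputable def harm (m : ℕ) : ℝ := ∑ i ∈ Finset.range m, 1 / ((i : ℝ) + 1)

theorem harm_le {m : ℕ} (hm : 2 ≤ m) : harm m ≤ 2 * Real.logb 2 m := by
  have h1 : harm m = (harmonic m : ℝ) := by
    simp [harm, harmonic, one_div]
  have h2 := harmonic_le_one_add_log m
  have h3 : (1 : ℝ) ≤ Real.logb 2 m := by
    rw [Real.le_logb_iff_rpow_le (by norm_num) (by positivity)]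
    simpa using hm
  have h4 : Real.log m ≤ Real.logb 2 m := by
    rw [Real.logb]
    have := Real.log_two_lt_d9
    exact le_div_self (Real.log_natCast_nonneg m) (Real.log_pos (by norm_num)) (by linarith)
  linarith

theorem one_le_harm {m : ℕ} (hm : 0 < m) : 1 ≤ harm m := by
  have := Finset.single_le_sum (f := fun i : ℕ => 1 / ((i : ℝ) + 1)) (s := Finset.range m)
    (fun i _ => by positivity) (Finset.mem_range.2 hm)
  simpa [harm] using this

/-- On each side of `j` the distances `|j - l|` are distinct integers between 1 and `m`. -/
theorem sum_one_div_abs_sub_le {m j : ℕ} (hj : j ≤ m) {S : Finset ℕ}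
    (hS : ∀ l ∈ S, l ≤ m ∧ l ≠ j) : ∑ l ∈ S, 1 / |(j : ℝ) - l| ≤ 2 * harm m := by
  have hsplit : S = S.filter (· < j) ∪ S.filter (j < ·) := by
    ext l
    simp only [Finset.mem_union, Finset.mem_filter]
    constructor
    · intro h
      have := (hS l h).2
      rcases lt_or_gt_of_ne this with h' | h'
      · exact Or.inl ⟨h, h'⟩
      · exact Or.inr ⟨h, h'⟩
    · rintro (h | h) <;> exact h.1
  have hdisj : Disjoint (S.filter (· < j)) (S.filter (j < ·)) := by
    rw [Finset.disjoint_filter]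
    intro l _ h
    omega
  have key : ∀ (U : Finset ℕ) (g : ℕ → ℕ), (∀ l ∈ U, g l < m) →
      (Set.InjOn g U) → (∀ l ∈ U, |(j : ℝ) - l| = g l + 1) →
      ∑ l ∈ U, 1 / |(j : ℝ) - l| ≤ harm m := by
    intro U g h1 h2 h3
    rw [Finset.sum_congr rfl fun l hl => by rw [h3 l hl],
      ← Finset.sum_image (f := fun i : ℕ => 1 / ((i : ℝ) + 1)) h2]
    refine Finset.sum_le_sum_of_subset_of_nonneg ?_ fun i _ _ => by positivity
    intro i hi
    obtain ⟨l, hl, rfl⟩ := Finset.mem_image.1 hi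
    exact Finset.mem_range.2 (h1 l hl)
  rw [hsplit, Finset.sum_union hdisj, two_mul]
  refine add_le_add (key _ (fun l => j - l - 1) ?_ ?_ ?_) (key _ (fun l => l - j - 1) ?_ ?_ ?_)
  · intro l hl
    have := (Finset.mem_filter.1 hl).2
    omega
  · intro l hl l' hl' h
    have h1 := (Finset.mem_filter.1 hl).2
    have h2 := (Finset.mem_filter.1 hl').2
    dsimp only at h
    omega
  · intro l hl
    have h1 := (Finset.mem_filter.1 hl).2
    obtain ⟨d, rfl⟩ := Nat.exists_eq_add_of_lt h1
    have : l + d + 1 - l - 1 = d := by omega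
    rw [this]
    push_cast
    rw [abs_of_nonneg] <;> ring_nf
    positivity
  · intro l hl
    have := (hS l (Finset.mem_filter.1 hl).1).1
    have := (Finset.mem_filter.1 hl).2
    omega
  · intro l hl l' hl' h
    have h1 := (Finset.mem_filter.1 hl).2
    have h2 := (Finset.mem_filter.1 hl').2
    dsimp only at h
    omega
  · intro l hl
    have h1 := (Finset.mem_filter.1 hl).2
    obtain ⟨d, rfl⟩ := Nat.exists_eq_add_of_lt h1
    have : j + d + 1 - j - 1 = d := by omega
    rw [this, abs_sub_comm]
    push_cast
    rw [abs_of_nonneg] <;> ring_nf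
    positivity

/-- Cauchy–Schwarz for the function that counts how many of the sets contain a given element: its
sum is the total size, its sum of squares the total size of the pairwise intersections. -/
theorem sq_sum_card_le {ι κ : Type*} [Fintype κ] [DecidableEq κ] (B : Finset ι)
    (S : ι → Finset κ) :
    (∑ j ∈ B, ((S j).card : ℝ)) ^ 2 ≤
      Fintype.card κ * ∑ j ∈ B, ∑ l ∈ B, ((S j ∩ S l).card : ℝ) := by
  have h1 : ∑ j ∈ B, ((S j).card : ℝ) = ∑ i : κ, ∑ j ∈ B, if i ∈ S j then (1 : ℝ) else 0 := by
    rw [Finset.sum_comm]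
    simp
  have h2 : ∑ j ∈ B, ∑ l ∈ B, ((S j ∩ S l).card : ℝ) =
      ∑ i : κ, (∑ j ∈ B, if i ∈ S j then (1 : ℝ) else 0) ^ 2 := by
    simp only [sq, Finset.sum_mul_sum]
    rw [Finset.sum_comm]
    conv_rhs => rw [Finset.sum_comm]
    rw [Finset.sum_comm]
    refine Finset.sum_congr rfl fun j _ => ?_
    rw [Finset.sum_comm]
    refine Finset.sum_congr rfl fun l _ => ?_
    simp [← ite_and, ← Finset.mem_inter, Finset.inter_comm (S l)]
  rw [h1, h2]
  exact sq_sum_le_card_mul_sum_sq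

/-- At most half of the directions `(m, j)`, `0 ≤ j ≤ m`, have a line that crosses many disks. -/
theorem DiskFamily.two_mul_card_le {m : ℕ} (hm : 0 < m) (D : DiskFamily m) (B : Finset ℕ)
    (hB : ∀ j ∈ B, j ≤ m) (c : ℕ → ℝ)
    (hc : ∀ j ∈ B, 650 * m * harm m < ((D.crossing m j (c j)).card : ℝ) ^ 2) :
    2 * B.card ≤ m := by
  rcases B.eq_empty_or_nonempty with rfl | hne
  · simp
  have hm' : (0 : ℝ) < m := by exact_mod_cast hm
  have hH := one_le_harm hm
  have hb : (0 : ℝ) < B.card := by exact_mod_cast hne.card_pos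
  set t := √(650 * m * harm m) with ht
  have h1 : B.card * t ≤ ∑ j ∈ B, ((D.crossing m j (c j)).card : ℝ) := by
    rw [← nsmul_eq_mul]
    refine Finset.card_nsmul_le_sum _ _ _ fun j hj => ?_
    rw [ht, Real.sqrt_le_left (by positivity)]
    exact (hc j hj).le
  have h2 := sq_sum_card_le B fun j => D.crossing m j (c j)
  rw [Fintype.card_fin] at h2
  have hsym : ∀ j ∈ B, ∀ l ∈ B, l ≠ j →
      ((D.crossing m j (c j) ∩ D.crossing m l (c l)).card : ℝ) ≤
        162 * m * (1 / |(j : ℝ) - l|) := by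
    intro j hj l hl hne
    rcases lt_or_gt_of_ne hne with h | h
    · have hlt : (l : ℝ) < j := by exact_mod_cast h
      refine (D.card_crossing_inter_le hm (hB j hj) h (c j) (c l)).trans (le_of_eq ?_)
      rw [abs_of_pos (by linarith)]
      ring
    · have hlt : (j : ℝ) < l := by exact_mod_cast h
      rw [Finset.inter_comm, abs_sub_comm]
      refine (D.card_crossing_inter_le hm (hB l hl) h (c l) (c j)).trans (le_of_eq ?_)
      rw [abs_of_pos (by linarith)]
      ring
  have h3 : ∀ j ∈ B, ∑ l ∈ B, ((D.crossing m j (c j) ∩ D.crossing m l (c l)).card : ℝ) ≤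
      325 * m * harm m := by
    intro j hj
    rw [← Finset.add_sum_erase _ _ hj]
    have e1 : ((D.crossing m j (c j) ∩ D.crossing m j (c j)).card : ℝ) ≤ m := by
      have := Finset.card_le_univ (D.crossing m j (c j) ∩ D.crossing m j (c j))
      rw [Fintype.card_fin] at this
      exact_mod_cast this
    have e2 : ∑ l ∈ B.erase j, ((D.crossing m j (c j) ∩ D.crossing m l (c l)).card : ℝ) ≤
        162 * m * (2 * harm m) := by
      refine (Finset.sum_le_sum fun l hl => hsym j hj l (Finset.mem_of_mem_erase hl)
        (Finset.ne_of_mem_erase hl)).trans ?_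
      rw [← Finset.mul_sum]
      gcongr
      exact sum_one_div_abs_sub_le (hB j hj) fun l hl =>
        ⟨hB l (Finset.mem_of_mem_erase hl), Finset.ne_of_mem_erase hl⟩
    -- The diagonal term `m` is at most `m * harm m`, and 1 + 2 · 162 = 325.
    nlinarith
  have h4 := Finset.sum_le_card_nsmul _ _ _ h3
  rw [nsmul_eq_mul] at h4
  have h5 : (B.card * t) ^ 2 ≤ m * (B.card * (325 * m * harm m)) := by
    refine le_trans (pow_le_pow_left₀ (by positivity) h1 2) (h2.trans ?_)
    gcongr
  rw [mul_pow, ht, Real.sq_sqrt (by positivity)] at h5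
  -- The threshold 650 is twice 325; this factor is the 2 in the conclusion.
  have h6 : (B.card * 2 : ℝ) * (B.card * (325 * m * harm m)) ≤
      m * (B.card * (325 * m * harm m)) := by linarith
  have h7 := le_of_mul_le_mul_right h6 (by positivity)
  have h8 : B.card * 2 ≤ m := by exact_mod_cast h7
  omega

/-! ### Rank selection in lists of reals -/

/-- `t` is the element of rank `k` (counted from `0`) of the list `l`. -/
def IsKth (l : List ℝ) (k : ℕ) (t : ℝ) : Prop :=
  l.countP (fun x => decide (x < t)) ≤ k ∧ k < l.countP (fun x => decide (x ≤ t))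

theorem List.countP_lt_mono (l : List ℝ) {p q : ℝ} (h : p ≤ q) :
    l.countP (fun x => decide (x < p)) ≤ l.countP (fun x => decide (x < q)) :=
  List.countP_mono_left fun x _ hx => by simp at hx ⊢; linarith

theorem List.countP_le_le_countP_lt (l : List ℝ) {p q : ℝ} (h : p < q) :
    l.countP (fun x => decide (x ≤ p)) ≤ l.countP (fun x => decide (x < q)) :=
  List.countP_mono_left fun x _ hx => by simp at hx ⊢; linarith

/-- With `IsKth.le_iff`, this lets the program locate the unknown `t` relative to a pivot by
counting alone. -/
theorem IsKth.lt_iff {l : List ℝ} {k : ℕ} {t : ℝ} (h : IsKth l k t) (p : ℝ) :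
    t < p ↔ k < l.countP (fun x => decide (x < p)) := by
  constructor
  · intro hp
    exact h.2.trans_le (l.countP_le_le_countP_lt hp)
  · intro hk
    by_contra! hp
    have := l.countP_lt_mono hp
    have := h.1
    omega

theorem IsKth.le_iff {l : List ℝ} {k : ℕ} {t : ℝ} (h : IsKth l k t) (p : ℝ) :
    t ≤ p ↔ k < l.countP (fun x => decide (x ≤ p)) := by
  constructor
  · intro hp
    exact h.2.trans_le (List.countP_mono_left fun x _ hx => by simp at hx ⊢; linarith)
  · intro hk
    by_contra! hp
    have := l.countP_le_le_countP_lt hp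
    have := h.1
    omega

/-- All discarded items exceed `t`, so the rank is unchanged. The factor `-1` is the value of
`side`, so that one test covers every case. -/
theorem IsKth.filter_lt {l : List ℝ} {k : ℕ} {t : ℝ} (h : IsKth l k t) {p : ℝ} (hp : t < p) :
    IsKth (l.filter fun x => decide (0 < (-1) * (x - p))) k t := by
  rw [IsKth, List.countP_filter, List.countP_filter]
  have h1 : ∀ x : ℝ, (decide (x < t) && decide (0 < (-1) * (x - p))) = decide (x < t) := by
    intro x
    rw [← Bool.decide_and, decide_eq_decide]
    exact ⟨And.left, fun hx => ⟨hx, by linarith⟩⟩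
  have h2 : ∀ x : ℝ, (decide (x ≤ t) && decide (0 < (-1) * (x - p))) = decide (x ≤ t) := by
    intro x
    rw [← Bool.decide_and, decide_eq_decide]
    exact ⟨And.left, fun hx => ⟨hx, by linarith⟩⟩
  simp only [h1, h2]
  exact h

theorem List.countP_eq_countP_and_add (l : List ℝ) (P R : ℝ → Bool) :
    l.countP P = l.countP (fun x => P x && R x) + l.countP (fun x => P x && !R x) := by
  rw [List.countP_eq_countP_filter_add l P R, List.countP_filter, List.countP_filter]

/-- All discarded items are below `t`, so both counts in `IsKth` drop by their number. -/
theorem IsKth.filter_gt {l : List ℝ} {k : ℕ} {t : ℝ} (h : IsKth l k t) {p : ℝ} (hp : p < t) :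
    IsKth (l.filter fun x => decide (0 < 1 * (x - p)))
      (k - l.countP (fun x => decide (x ≤ p))) t := by
  have hk : ¬ k < l.countP (fun x => decide (x ≤ p)) := by
    rw [← h.le_iff p]; exact not_le.2 hp
  rw [IsKth, List.countP_filter, List.countP_filter]
  have e : ∀ P : ℝ → Bool, (∀ x, x ≤ p → P x = true) → l.countP P =
      l.countP (fun x => P x && decide (0 < 1 * (x - p))) +
        l.countP (fun x => decide (x ≤ p)) := by
    intro P hP
    rw [l.countP_eq_countP_and_add P fun x => decide (0 < 1 * (x - p))]
    congr 2
    funext x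
    by_cases hx : x ≤ p
    · have : ¬ 0 < x - p := by linarith
      simp [hx, hP x hx]
    · simp [hx, not_le.1 hx]
  have h1 := e (fun x => decide (x < t)) fun x hx => by simp; linarith
  have h2 := e (fun x => decide (x ≤ t)) fun x hx => by simp; linarith
  have := h.1
  have := h.2
  omega

/-- Take the least item `t` with more than `k` items `≤ t`; if more than `k` items were below `t`,
the largest of those would contradict minimality. -/
theorem exists_isKth (l : List ℝ) {k : ℕ} (hk : k < l.length) : ∃ t, IsKth l k t := by
  classical
  have hne : (l.toFinset.filter fun p => k < l.countP (fun x => decide (x ≤ p))).Nonempty := by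
    obtain ⟨b, hb, hmax⟩ := l.toFinset.exists_max_image id
      ⟨l[k], by simp⟩
    refine ⟨b, Finset.mem_filter.2 ⟨hb, ?_⟩⟩
    rwa [List.countP_eq_length.2]
    intro x hx
    simpa using hmax x (by simpa using hx)
  obtain ⟨t, ht, hmin⟩ := Finset.exists_min_image _ id hne
  rw [Finset.mem_filter] at ht
  refine ⟨t, ?_, ht.2⟩
  by_contra! hlt
  have hne' : (l.toFinset.filter fun x => x < t).Nonempty := by
    obtain ⟨a, ha, hat⟩ := List.countP_pos_iff.1 (by omega : 0 < l.countP fun x => decide (x < t))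
    exact ⟨a, by simpa using ⟨ha, by simpa using hat⟩⟩
  obtain ⟨q, hq, hqmax⟩ := Finset.exists_max_image _ id hne'
  rw [Finset.mem_filter] at hq
  have h1 : l.countP (fun x => decide (x < t)) ≤ l.countP (fun x => decide (x ≤ q)) := by
    refine List.countP_mono_left fun x hx hxt => ?_
    simp only [decide_eq_true_eq] at hxt ⊢
    exact hqmax x (by simpa using ⟨hx, hxt⟩)
  have := hmin q (Finset.mem_filter.2 ⟨hq.1, by omega⟩)
  simp only [id] at this
  linarith [hq.2]

theorem countP_map_range (A : ℕ → ℝ) (n : ℕ) (P : ℝ → Prop) [DecidablePred P] :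
    ((List.range n).map A).countP (fun x => decide (P x)) =
      ∑ q ∈ Finset.range n, if P (A q) then 1 else 0 := by
  induction n with
  | zero => simp
  | succ n ih =>
    rw [List.range_succ, Finset.sum_range_succ, List.map_append, List.countP_append, ih]
    simp [List.countP_cons]

/-- The direction in which the rank search proceeds from the pivot `p` when it looks for `t`. -/
noncomputable def side (t p : ℝ) : ℝ := if t < p then -1 else if p < t then 1 else 0

/-- A uniformly random pivot leaves on average at most three quarters of the items. For two items on
the same side of `t`, at most one survives when the other is the pivot; both can survive only across
`t`. With `a` items below and `b` above, twice the sum is thus at most `n² + 2ab ≤ 3n² / 2`. -/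
theorem four_mul_sum_length_le (A : ℕ → ℝ) (n : ℕ) (t : ℝ) :
    4 * ∑ z ∈ Finset.range n,
      (((List.range n).map A).filter fun x => decide (0 < side t (A z) * (x - A z))).length
        ≤ 3 * n ^ 2 := by
  simp only [← List.countP_eq_length_filter, countP_map_range]
  set f : ℕ → ℕ → ℕ := fun z q => if 0 < side t (A z) * (A q - A z) then 1 else 0
  set L : ℕ → ℕ := fun z => if A z < t then 1 else 0
  set R : ℕ → ℕ := fun z => if t < A z then 1 else 0
  have h1 : ∀ z q, f z q + f q z ≤ 1 + (L z * R q + R z * L q) := by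
    intro z q
    simp only [f, L, R, side]
    rcases lt_trichotomy (A z) t with h | h | h <;> rcases lt_trichotomy (A q) t with h' | h' | h'
      <;> simp [h, h', h.le, h'.le, not_lt_of_ge] <;> split_ifs <;> first | omega | linarith
  have h2 : ∑ z ∈ Finset.range n, ∑ q ∈ Finset.range n, (f z q + f q z) ≤
      ∑ z ∈ Finset.range n, ∑ q ∈ Finset.range n, (1 + (L z * R q + R z * L q)) :=
    Finset.sum_le_sum fun z _ => Finset.sum_le_sum fun q _ => h1 z q
  simp only [Finset.sum_add_distrib, ← Finset.mul_sum, ← Finset.sum_mul] at h2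
  rw [Finset.sum_comm (f := fun z q => f q z)] at h2
  simp only [Finset.sum_const, Finset.card_range, smul_eq_mul, mul_one] at h2
  have h3 : ∑ z ∈ Finset.range n, L z + ∑ z ∈ Finset.range n, R z ≤ n := by
    rw [← Finset.sum_add_distrib]
    refine (Finset.sum_le_card_nsmul _ _ 1 fun z _ => ?_).trans (by simp)
    simp only [L, R]
    split_ifs <;> first | omega | linarith
  change 4 * ∑ z ∈ Finset.range n, ∑ q ∈ Finset.range n, f z q ≤ _
  generalize ∑ z ∈ Finset.range n, L z = a at *
  generalize ∑ z ∈ Finset.range n, R z = b at *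
  generalize ∑ z ∈ Finset.range n, ∑ q ∈ Finset.range n, f z q = S at *
  have h4 : 4 * (a * b) ≤ (a + b) ^ 2 := by
    zify
    nlinarith [sq_nonneg ((a : ℤ) - b)]
  have h5 : (a + b) ^ 2 ≤ n ^ 2 := Nat.pow_le_pow_left h3 2
  nlinarith

/-! ### Derived commands: conditional increments and counting loops -/

namespace RealRAM

/-- Cell `0` of the integer array `a`. -/
abbrev nv (a : ℕ) : NExpr := .cell a (.const 0)

/-- Cell `i` of the real array `a`. -/
abbrev rv (a i : ℕ) : RExpr := .cell a (.const i)

open Classical in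
/-- The truth value of a test, as a number. -/
noncomputable def Test.toNat (b : Test) (s : Store) : ℕ := if b.Holds s then 1 else 0

/-- Increment cell `0` of the integer array `a` if the test `b` succeeds. -/
def incIf (b : Test) (a : ℕ) : Program :=
  .ite b (.setNat a (.const 0) (.add (nv a) (.const 1))) (.setNat a (.const 0) (nv a))

theorem Runs.incIf (b : Test) (a : ℕ) (s : Store) :
    Runs (incIf b a) 2 s (s.setNat a 0 (s.nat a 0 + b.toNat s)) := by
  by_cases h : b.Holds s
  · simpa [RealRAM.incIf, NExpr.eval, Test.toNat, h] using
      Runs.ite_pos h (Runs.setNat a (.const 0) (.add (nv a) (.const 1)) s)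
  · simpa [RealRAM.incIf, NExpr.eval, Test.toNat, h] using
      Runs.ite_neg h (Runs.setNat a (.const 0) (nv a) s)

/-- Execute `body` for the values `0, 1, …` below `bound` of the loop counter, which is cell `0` of
the integer array `2`. -/
def forLoop (bound : NExpr) (body : Program) : Program :=
  .seq (.setNat 2 (.const 0) (.const 0))
    (.whileDo (.natLt (nv 2) bound)
      (.seq body (.setNat 2 (.const 0) (.add (nv 2) (.const 1)))))

theorem Runs.forLoop {bound : NExpr} {body : Program} {k N : ℕ} (I : ℕ → Store → Prop)
    (hN : ∀ t s, I t s → bound.eval s = N) (hi : ∀ t s, I t s → s.nat 2 0 = t)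
    (hstep : ∀ t < N, ∀ s, I t s →
      ∃ s', Runs body k s s' ∧ I (t + 1) (s'.setNat 2 0 (s'.nat 2 0 + 1)))
    {s : Store} (hs : I 0 (s.setNat 2 0 0)) :
    ∃ s', Runs (forLoop bound body) (N * (k + 3) + 3) s s' ∧ I N s' := by
  obtain ⟨s', hr, hs'⟩ := Runs.while_of_invariant (b := .natLt (nv 2) bound)
    (p := .seq body (.setNat 2 (.const 0) (.add (nv 2) (.const 1)))) (k := 1 + k + 1) (N := N) I
    (fun t ht s hI => by
      refine ⟨by simpa [Test.Holds, NExpr.eval, hi t s hI, hN t s hI] using ht, ?_⟩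
      obtain ⟨s', hr, hs'⟩ := hstep t ht s hI
      exact ⟨_, hr.seq (Runs.setNat _ _ _ _), hs'⟩)
    (fun s hI => by simp [Test.Holds, NExpr.eval, hi N s hI, hN N s hI]) hs
  refine ⟨s', ((Runs.setNat 2 (.const 0) (.const 0) s).seq hr).mono ?_, hs'⟩
  have : 1 + k + 1 + 1 = k + 3 := by ring
  rw [this]
  omega

/-! ### The program -/

/-- Cell `4, i` where `i` is the loop counter. -/
abbrev item : RExpr := .cell 4 (nv 2)

/-- The linear form with the coefficients in cells `0` and `1` of the real array `3`, evaluated at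
the center whose index is the loop counter. -/
abbrev formExpr : RExpr :=
  .add (.mul (rv 3 0) (.cell 0 (nv 2))) (.mul (rv 3 1) (.cell 1 (nv 2)))

/-- Store the values of the linear form at the centers, and compute half the number of disks. -/
def fill : Program :=
  .seq (.setNat 5 (.const 0) (.const 0))
    (.seq (forLoop (nv 0) (.seq (.setReal 4 (nv 2) formExpr)
      (.setNat 5 (.const 0) (.sub (nv 2) (nv 5)))))
    (.setNat 4 (.const 0) (nv 0)))

/-- Count the items that are smaller than the pivot and those that are not larger. -/
def rankPivot : Program :=
  .seq (.setReal 3 (.const 2) (.cell 4 (nv 6)))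
    (.seq (.setNat 7 (.const 0) (.const 0))
    (.seq (.setNat 8 (.const 0) (.const 0))
    (forLoop (nv 4) (.seq (incIf (.realLt item (rv 3 2)) 7)
      (incIf (.not (.realLt (rv 3 2) item)) 8)))))

/-- Decide on which side of the pivot the search continues. -/
def chooseSide : Program :=
  .ite (.natLt (nv 5) (nv 7)) (.setReal 5 (.const 0) (.const (-1)))
    -- The pivot is the wanted element: with factor `0` no item passes the test in `shrink`, and the
    -- search ends.
    (.ite (.natLt (nv 5) (nv 8)) (.setReal 5 (.const 0) (.const 0))
      (.seq (.setReal 5 (.const 0) (.const 1)) (.setNat 5 (.const 0) (.sub (nv 5) (nv 8)))))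

/-- Keep only the items on the chosen side of the pivot. -/
def shrink : Program :=
  .seq (.setNat 9 (.const 0) (.const 0))
    (.seq (forLoop (nv 4) (.seq (.setReal 4 (nv 9) item)
      (incIf (.realLt (.const 0) (.mul (rv 5 0) (.sub item (rv 3 2)))) 9)))
    (.setNat 4 (.const 0) (nv 9)))

/-- The part of a round of the rank search that follows the choice of the pivot. -/
def selectRest : Program := .seq rankPivot (.seq chooseSide shrink)

/-- The rank search. -/
def select : Program :=
  .whileDo (.natLt (.const 0) (nv 4))
    (.seq (.rand 6 (.const 0) (.sub (nv 4) (.const 1))) selectRest)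

/-- Count the disks that cross the line, and compute the harmonic sum. -/
def countCrossing : Program :=
  .seq (.setNat 10 (.const 0) (.const 0))
    (.seq (.setReal 5 (.const 0) (.const 0))
    (forLoop (nv 0) (.seq
      (incIf (.not (.realLt
        (.mul (.mul (rv 2 0) (rv 2 0)) (.add (.mul (rv 3 0) (rv 3 0)) (.mul (rv 3 1) (rv 3 1))))
        (.mul (.sub formExpr (rv 3 2)) (.sub formExpr (rv 3 2))))) 10)
      (.setReal 5 (.const 0)
        (.add (rv 5 0) (.div (.const 1) (.add (.ofNat (nv 2)) (.const 1))))))))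

/-- Stop if the line crosses few disks. -/
def accept : Program :=
  incIf (.not (.realLt (.mul (.mul (.const 650) (.ofNat (nv 0))) (rv 5 0))
    (.mul (.ofNat (nv 10)) (.ofNat (nv 10))))) 1

/-- The coefficients of the linear form, from the random integer. -/
def setDirection : Program :=
  .seq (.setReal 3 (.const 0) (.ofNat (nv 0))) (.setReal 3 (.const 1) (.ofNat (nv 3)))

/-- Try random directions until one is good. -/
def separate : Program :=
  .whileDo (.natLt (nv 1) (.const 1))
    (.seq (.rand 3 (.const 0) (nv 0))
      (.seq (.seq setDirection fill) (.seq select (.seq countCrossing accept))))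

/-! ### Correctness of the parts -/

/-- The memory still contains the input. -/
def Base {m : ℕ} (D : DiskFamily m) (s : Store) : Prop :=
  s.nat 0 0 = m ∧ s.real 0 = D.input.real 0 ∧ s.real 1 = D.input.real 1 ∧ s.real 2 0 = D.radius

/-- The memory contains the input and the direction `(m, j)`, and the search is not finished. -/
def Ready {m : ℕ} (D : DiskFamily m) (j : ℕ) (s : Store) : Prop :=
  Base D s ∧ s.nat 1 0 = 0 ∧ s.real 3 0 = m ∧ s.real 3 1 = j

/-- The value of the linear form `m x + j y` at the center with index `q`. -/
noncomputable def inputForm {m : ℕ} (D : DiskFamily m) (j q : ℕ) : ℝ :=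
  m * D.input.real 0 q + j * D.input.real 1 q

theorem runs_fill {m : ℕ} (D : DiskFamily m) (j : ℕ) {s : Store} (hs : Ready D j s) :
    ∃ s', Runs fill (m * 6 + 7) s s' ∧ Ready D j s' ∧ s'.nat 4 0 = m ∧ s'.nat 5 0 = m / 2 ∧
      ∀ q < m, s'.real 4 q = inputForm D j q := by
  obtain ⟨s', hr, hs'⟩ := Runs.forLoop (bound := nv 0)
    (body := .seq (.setReal 4 (nv 2) formExpr) (.setNat 5 (.const 0) (.sub (nv 2) (nv 5))))
    (k := 1 + 1 + 1) (N := m)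
    -- Halving without division: `t - t / 2 = (t + 1) / 2`.
    (fun t s => Ready D j s ∧ s.nat 2 0 = t ∧ s.nat 5 0 = t / 2 ∧
      ∀ q < t, s.real 4 q = inputForm D j q)
    (fun t s h => by simp [NExpr.eval, h.1.1.1])
    (fun t s h => h.2.1)
    (fun t ht s h => by
      refine ⟨_, (Runs.setReal _ _ _ _).seq (Runs.setNat _ _ _ _), ?_⟩
      obtain ⟨⟨⟨h1, h2, h3, h4⟩, h5, h6, h7⟩, h8, h9, h10⟩ := h
      refine ⟨by simp [Ready, Base, Store.setNat, Store.setReal, h1, h2, h3, h4, h5, h6, h7], ?_⟩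
      refine ⟨by simp [Store.setNat, Store.setReal, h8], ?_, ?_⟩
      · simp [Store.setNat, Store.setReal, NExpr.eval, h8, h9]
        omega
      · intro q hq
        rcases Nat.lt_succ_iff_lt_or_eq.1 hq with h | rfl
        · simp [Store.setNat, Store.setReal, NExpr.eval, h8, h.ne, h10 q h]
        · simp [Store.setNat, Store.setReal, NExpr.eval, RExpr.eval, h8, h6, h7, h2, h3,
            inputForm])
    (s := s.setNat 5 0 0) (by
      obtain ⟨⟨h1, h2, h3, h4⟩, h5, h6, h7⟩ := hs
      simp [Ready, Base, Store.setNat, h1, h2, h3, h4, h5, h6, h7])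
  obtain ⟨⟨⟨h1, h2, h3, h4⟩, h5, h6, h7⟩, h8, h9, h10⟩ := hs'
  refine ⟨_, ((Runs.setNat 5 (.const 0) (.const 0) s).seq
    (hr.seq (Runs.setNat 4 (.const 0) (nv 0) s'))).mono (by omega), ?_⟩
  simpa [Ready, Base, Store.setNat, NExpr.eval, h1, h2, h3, h4, h5, h6, h7, h9] using h10

/-- The items among which the rank search continues. -/
def items (s : Store) : List ℝ := (List.range (s.nat 4 0)).map (s.real 4)

theorem runs_rankPivot {m : ℕ} (D : DiskFamily m) (j : ℕ) {s : Store} (hs : Ready D j s) :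
    ∃ s', Runs rankPivot (s.nat 4 0 * 8 + 9) s s' ∧ Ready D j s' ∧
      s'.nat 4 0 = s.nat 4 0 ∧ s'.nat 5 0 = s.nat 5 0 ∧ s'.real 4 = s.real 4 ∧
      s'.real 3 2 = s.real 4 (s.nat 6 0) ∧
      s'.nat 7 0 = (items s).countP (fun x => decide (x < s.real 4 (s.nat 6 0))) ∧
      s'.nat 8 0 = (items s).countP (fun x => decide (x ≤ s.real 4 (s.nat 6 0))) := by
  set p := s.real 4 (s.nat 6 0) with hp
  set A := s.real 4 with hA
  set n := s.nat 4 0 with hn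
  obtain ⟨s', hr, hs'⟩ := Runs.forLoop (bound := nv 4)
    (body := .seq (incIf (.realLt item (rv 3 2)) 7) (incIf (.not (.realLt (rv 3 2) item)) 8))
    (k := 1 + 2 + 2) (N := n)
    (fun t s' => Ready D j s' ∧ s'.nat 2 0 = t ∧ s'.nat 4 0 = n ∧ s'.nat 5 0 = s.nat 5 0 ∧
      s'.real 4 = A ∧ s'.real 3 2 = p ∧
      s'.nat 7 0 = ∑ q ∈ Finset.range t, (if A q < p then 1 else 0) ∧
      s'.nat 8 0 = ∑ q ∈ Finset.range t, (if A q ≤ p then 1 else 0))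
    (fun t s h => by simp [NExpr.eval, h.2.2.1])
    (fun t s h => h.2.1)
    (fun t ht s h => by
      refine ⟨_, (Runs.incIf _ _ _).seq (Runs.incIf _ _ _), ?_⟩
      obtain ⟨⟨⟨h1, h2, h3, h4⟩, h5, h6, h7⟩, h8, h9, h10, h11, h12, h13, h14⟩ := h
      rw [Finset.sum_range_succ, Finset.sum_range_succ]
      simp [Ready, Base, Store.setNat, Test.toNat, Test.Holds, NExpr.eval, RExpr.eval, h1, h2, h3,
        h4, h5, h6, h7, h8, h9, h10, h11, h12, h13, h14])
    (s := ((s.setReal 3 2 p).setNat 7 0 0).setNat 8 0 0) (by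
      obtain ⟨⟨h1, h2, h3, h4⟩, h5, h6, h7⟩ := hs
      simp [Ready, Base, Store.setNat, Store.setReal, h1, h2, h3, h4, h5, h6, h7, hn, hA])
  obtain ⟨h1, h2, h3, h4, h5, h6, h7, h8⟩ := hs'
  refine ⟨s', ((Runs.setReal 3 (.const 2) (.cell 4 (nv 6)) s).seq
    ((Runs.setNat 7 (.const 0) (.const 0) _).seq
    ((Runs.setNat 8 (.const 0) (.const 0) _).seq hr))).mono (by omega), h1, h3, h4, h5, h6, ?_, ?_⟩
  · rw [h7, items, countP_map_range]
  · rw [h8, items, countP_map_range]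

theorem runs_chooseSide {m : ℕ} (D : DiskFamily m) (j : ℕ) {s : Store} {t p : ℝ}
    (hs : Ready D j s) (ht : IsKth (items s) (s.nat 5 0) t)
    (h7 : s.nat 7 0 = (items s).countP (fun x => decide (x < p)))
    (h8 : s.nat 8 0 = (items s).countP (fun x => decide (x ≤ p))) :
    ∃ s', Runs chooseSide 5 s s' ∧ Ready D j s' ∧
      s'.nat 4 0 = s.nat 4 0 ∧ s'.real 4 = s.real 4 ∧ s'.real 3 2 = s.real 3 2 ∧
      s'.real 5 0 = side t p ∧
      (p ≠ t → IsKth ((items s).filter fun x => decide (0 < side t p * (x - p)))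
        (s'.nat 5 0) t) := by
  obtain ⟨⟨h1, h2, h3, h4⟩, h5, h6, h7'⟩ := hs
  have hlt := ht.lt_iff p
  have hle := ht.le_iff p
  rw [← h7] at hlt
  rw [← h8] at hle
  by_cases hc : t < p
  · refine ⟨_, (Runs.ite_pos (by simpa [Test.Holds, NExpr.eval] using hlt.1 hc)
      (Runs.setReal 5 (.const 0) (.const (-1)) s)).mono (by norm_num), ?_⟩
    have := ht.filter_lt hc
    simpa [Ready, Base, Store.setReal, NExpr.eval, RExpr.eval, side, hc, h1, h2, h3, h4, h5, h6,
      h7'] using fun _ => this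
  · have hc' : ¬ (Test.natLt (nv 5) (nv 7)).Holds s := by
      simpa [Test.Holds, NExpr.eval] using fun h => hc (hlt.2 h)
    by_cases hd : t ≤ p
    · obtain rfl : p = t := le_antisymm (not_lt.1 hc) hd
      refine ⟨_, (Runs.ite_neg hc' (Runs.ite_pos
        (by simpa [Test.Holds, NExpr.eval] using hle.1 hd)
        (Runs.setReal 5 (.const 0) (.const 0) s))).mono (by norm_num), ?_⟩
      simp [Ready, Base, Store.setReal, NExpr.eval, RExpr.eval, side, h1, h2, h3, h4, h5, h6, h7']
    · refine ⟨_, (Runs.ite_neg hc' (Runs.ite_neg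
        (by simpa [Test.Holds, NExpr.eval] using fun h => hd (hle.2 h))
        ((Runs.setReal 5 (.const 0) (.const 1) s).seq
          (Runs.setNat 5 (.const 0) (.sub (nv 5) (nv 8)) _)))).mono (by norm_num), ?_⟩
      have := ht.filter_gt (not_le.1 hd)
      rw [← h8] at this
      simpa [Ready, Base, Store.setReal, Store.setNat, NExpr.eval, RExpr.eval, side, hc,
        not_le.1 hd, h1, h2, h3, h4, h5, h6, h7'] using fun _ => this

theorem runs_shrink {m : ℕ} (D : DiskFamily m) (j : ℕ) {s : Store} (hs : Ready D j s) :
    ∃ s', Runs shrink (s.nat 4 0 * 7 + 7) s s' ∧ Ready D j s' ∧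
      s'.nat 5 0 = s.nat 5 0 ∧ s'.real 3 2 = s.real 3 2 ∧
      items s' = (items s).filter fun x => decide (0 < s.real 5 0 * (x - s.real 3 2)) := by
  set p := s.real 3 2 with hp
  set σ := s.real 5 0 with hσ
  set A := s.real 4 with hA
  set n := s.nat 4 0 with hn
  set k := s.nat 5 0 with hk
  obtain ⟨s', hr, hs'⟩ := Runs.forLoop (bound := nv 4)
    (body := .seq (.setReal 4 (nv 9) item)
      (incIf (.realLt (.const 0) (.mul (rv 5 0) (.sub item (rv 3 2)))) 9))
    (k := 1 + 1 + 2) (N := n)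
    (fun t s' => Ready D j s' ∧ s'.nat 2 0 = t ∧ s'.nat 4 0 = n ∧ s'.nat 5 0 = k ∧
      -- The compaction is done in place: the write position never passes the read position, so
      -- unread items are intact.
      s'.real 3 2 = p ∧ s'.real 5 0 = σ ∧ s'.nat 9 0 ≤ t ∧ (∀ q, t ≤ q → s'.real 4 q = A q) ∧
      (List.range (s'.nat 9 0)).map (s'.real 4) =
        ((List.range t).map A).filter fun x => decide (0 < σ * (x - p)))
    (fun t s h => by simp [NExpr.eval, h.2.2.1])
    (fun t s h => h.2.1)
    (fun t ht s h => by
      refine ⟨_, (Runs.setReal _ _ _ _).seq (Runs.incIf _ _ _), ?_⟩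
      obtain ⟨⟨⟨h1, h2, h3, h4⟩, h5, h6, h7⟩, h8, h9, h10, h11, h12, h13, h14, h15⟩ := h
      have hAt : s.real 4 t = A t := h14 t le_rfl
      -- Each item is copied before it is tested, and only the counter depends on the test; the copy
      -- does not change the item being read, even if the two positions coincide.
      have hw : Function.update (s.real 4) (s.nat 9 0) (A t) t = A t := by
        rw [Function.update_apply]
        split_ifs
        · rfl
        · exact hAt
      have hmap : (List.range (s.nat 9 0)).map (Function.update (s.real 4) (s.nat 9 0) (A t)) =
          (List.range (s.nat 9 0)).map (s.real 4) := by
        refine List.map_congr_left fun q hq => ?_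
        rw [Function.update_of_ne (List.mem_range.1 hq).ne]
      refine ⟨by simp [Ready, Base, Store.setNat, Store.setReal, h1, h2, h3, h4, h5, h6, h7], ?_⟩
      by_cases hc : 0 < σ * (A t - p)
      · simp [Store.setNat, Store.setReal, Test.toNat, Test.Holds, NExpr.eval, RExpr.eval, h8, h9,
          h10, h11, h12, h13, hAt, hw, hc, hmap, h15, List.range_succ]
        intro q hq
        rw [Function.update_of_ne (by omega), h14 q (by omega)]
      · simp [Store.setNat, Store.setReal, Test.toNat, Test.Holds, NExpr.eval, RExpr.eval, h8, h9,
          h10, h11, h12, hAt, hw, hc, hmap, h15, List.range_succ]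
        refine ⟨by omega, fun q hq => ?_⟩
        rw [Function.update_of_ne (by omega), h14 q (by omega)])
    (s := s.setNat 9 0 0) (by
      obtain ⟨⟨h1, h2, h3, h4⟩, h5, h6, h7⟩ := hs
      simp [Ready, Base, Store.setNat, h1, h2, h3, h4, h5, h6, h7, hn, hA, hk, hp, hσ])
  obtain ⟨⟨⟨h1, h2, h3, h4⟩, h5, h6, h7⟩, h8, h9, h10, h11, h12, h13, h14, h15⟩ := hs'
  refine ⟨_, ((Runs.setNat 9 (.const 0) (.const 0) s).seq
    (hr.seq (Runs.setNat 4 (.const 0) (nv 9) s'))).mono (by omega), ?_⟩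
  simpa [Ready, Base, Store.setNat, NExpr.eval, h1, h2, h3, h4, h5, h6, h7, h10, h11, items]
    using h15

/-- The invariant of the search for the element `t` of prescribed rank. -/
def Searching {m : ℕ} (D : DiskFamily m) (j : ℕ) (t : ℝ) (s : Store) : Prop :=
  Ready D j s ∧ (0 < s.nat 4 0 → IsKth (items s) (s.nat 5 0) t) ∧
    (s.nat 4 0 = 0 → s.real 3 2 = t)

/-- The remaining list is empty exactly when the pivot was `t`: factor `0` removes everything, while
otherwise the list still has an element of the required rank. -/
theorem runs_selectRest {m : ℕ} (D : DiskFamily m) (j : ℕ) (t : ℝ) {s : Store}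
    (hs : Searching D j t s) (hn : 0 < s.nat 4 0) :
    ∃ s', Runs selectRest (40 * s.nat 4 0) s s' ∧ Searching D j t s' ∧
      s'.nat 4 0 = ((items s).filter fun x => decide (0 < side t (s.real 4 (s.nat 6 0)) *
        (x - s.real 4 (s.nat 6 0)))).length := by
  obtain ⟨s₁, r₁, b₁, hn₁, hk₁, hA₁, hp₁, hlo, hle⟩ := runs_rankPivot D j hs.1
  set p := s.real 4 (s.nat 6 0) with hp
  have hi₁ : items s₁ = items s := by rw [items, items, hn₁, hA₁]
  rw [← hi₁] at hlo hle
  have hkth := hs.2.1 hn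
  rw [← hi₁, ← hk₁] at hkth
  obtain ⟨s₂, r₂, b₂, hn₂, hA₂, hp₂, hσ, hkth₂⟩ := runs_chooseSide D j b₁ hkth hlo hle
  have hi₂ : items s₂ = items s := by rw [items, hn₂, hA₂, ← hi₁, items]
  obtain ⟨s₃, r₃, b₃, hk₃, hp₃, hi₃⟩ := runs_shrink D j b₂
  have hlen : s₃.nat 4 0 = (items s₃).length := by simp [items]
  rw [hσ, hp₂, hp₁, hi₂] at hi₃
  refine ⟨s₃, (r₁.seq (r₂.seq r₃)).mono (by omega), ⟨b₃, ?_, ?_⟩, by rw [hlen, hi₃]⟩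
  · intro hpos
    rw [hi₃, hk₃, ← hi₁]
    apply hkth₂
    rintro hpt
    rw [hlen, hi₃, hpt] at hpos
    simp [side] at hpos
  · intro hzero
    rw [hp₃, hp₂, hp₁]
    by_contra hne
    have h1 := (hkth₂ hne).2
    rw [hi₁, ← hi₃] at h1
    have h2 := List.countP_le_length (p := fun x => decide (x ≤ t)) (l := items s₃)
    omega

theorem cost_select_le {m : ℕ} (D : DiskFamily m) (j : ℕ) (t : ℝ) (Q : Store → Prop)
    (κ : List Program) (X n : ℕ)
    (hX : ∀ s, Ready D j s → s.real 3 2 = t → Config.cost Q n ⟨κ, s⟩ ≤ X) (s : Store)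
    (hs : Searching D j t s) :
    Config.cost Q n ⟨select :: κ, s⟩ ≤ (172 * s.nat 4 0 + 1 + X : ℕ) := by
  induction n generalizing s with
  | zero => simp [Config.cost]
  | succ n ih =>
    rcases Nat.eq_zero_or_pos (s.nat 4 0) with h0 | hpos
    · refine (Runs.while_neg (by simp [Test.Holds, NExpr.eval, h0]) Q (n + 1) κ).trans ?_
      rw [h0]
      push_cast
      simpa using hX s hs.1 (hs.2.2 h0)
    · rw [select, cost_succ_while (by simpa [Test.Holds, NExpr.eval] using hpos), ← select]
      set N := s.nat 4 0 with hN
      set g : ℕ → ℕ := fun z => (((List.range N).map (s.real 4)).filter fun x =>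
        decide (0 < side t (s.real 4 z) * (x - s.real 4 z))).length with hg
      have hsum : 4 * ∑ z ∈ Finset.range N, g z ≤ 3 * N ^ 2 := four_mul_sum_length_le _ _ _
      -- Here 129 is three quarters of 172, and 172 - 40 - 129 = 3 pays for the loop test, the
      -- sequencing and the draw.
      have hrand : Config.cost Q n ⟨.rand 6 (.const 0) (.sub (nv 4) (.const 1)) :: selectRest ::
          select :: κ, s⟩ ≤ (1 + (40 * N + 129 * N + 1 + X) : ℕ) := by
        refine cost_rand_le (k := N - 1) (by simp [NExpr.eval, hN])
          (fun z => 40 * N + (172 * g z + 1 + X)) _ ?_ ?_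
        · intro z hz
          set s' := s.setNat 6 ((NExpr.const 0).eval s) z with hs'
          have e1 : s'.nat 4 0 = N := by simp [hs', Store.setNat, hN]
          have e2 : items s' = items s := by simp [items, hs', Store.setNat]
          have e3 : s'.real 4 = s.real 4 := rfl
          have e4 : s'.nat 6 0 = z := by simp [hs', Store.setNat, NExpr.eval]
          have hsearch : Searching D j t s' := by
            obtain ⟨⟨⟨h1, h2, h3, h4⟩, h5, h6, h7⟩, h8, h9⟩ := hs
            refine ⟨by simp [Ready, Base, hs', Store.setNat, h1, h2, h3, h4, h5, h6, h7], ?_, ?_⟩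
            · rw [e1, e2]
              simpa [hs', Store.setNat] using h8
            · rw [e1]
              intro h
              omega
          obtain ⟨s₁, r₁, hs₁, hn₁⟩ := runs_selectRest D j t hsearch (by omega)
          rw [e2, e3, e4] at hn₁
          refine (r₁ Q n _).trans ?_
          rw [e1]
          push_cast
          gcongr
          refine (ih (fun s a b => (cost_le_succ _ _ _).trans (hX s a b)) s₁ hs₁).trans ?_
          rw [hn₁]
          push_cast
          exact le_rfl
        · rw [Nat.sub_add_cancel hpos]
          simp only [Finset.sum_add_distrib, ← Finset.mul_sum, Finset.sum_const, Finset.card_range,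
            smul_eq_mul]
          nlinarith
      have := (cost_seq_le Q n _ _ _ _).trans (add_le_add le_rfl hrand)
      refine (add_le_add le_rfl this).trans ?_
      norm_cast
      omega

theorem runs_countCrossing {m : ℕ} (D : DiskFamily m) (j : ℕ) {s : Store} (hs : Ready D j s) :
    ∃ s', Runs countCrossing (m * 7 + 7) s s' ∧ Ready D j s' ∧ s'.real 3 2 = s.real 3 2 ∧
      s'.nat 10 0 = (D.crossing m j (s.real 3 2)).card ∧ s'.real 5 0 = harm m := by
  set c := s.real 3 2 with hc
  obtain ⟨s', hr, hs'⟩ := Runs.forLoop (bound := nv 0)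
    (body := .seq
      (incIf (.not (.realLt
        (.mul (.mul (rv 2 0) (rv 2 0)) (.add (.mul (rv 3 0) (rv 3 0)) (.mul (rv 3 1) (rv 3 1))))
        (.mul (.sub formExpr (rv 3 2)) (.sub formExpr (rv 3 2))))) 10)
      (.setReal 5 (.const 0)
        (.add (rv 5 0) (.div (.const 1) (.add (.ofNat (nv 2)) (.const 1))))))
    (k := 1 + 2 + 1) (N := m)
    (fun t s' => Ready D j s' ∧ s'.nat 2 0 = t ∧ s'.real 3 2 = c ∧
      s'.nat 10 0 = ∑ q ∈ Finset.range t, (if ¬ D.radius ^ 2 * ((m : ℝ) ^ 2 + (j : ℝ) ^ 2) <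
        (inputForm D j q - c) ^ 2 then 1 else 0) ∧
      s'.real 5 0 = harm t)
    (fun t s h => by simp [NExpr.eval, h.1.1.1])
    (fun t s h => h.2.1)
    (fun t ht s h => by
      refine ⟨_, (Runs.incIf _ _ _).seq (Runs.setReal _ _ _ _), ?_⟩
      obtain ⟨⟨⟨h1, h2, h3, h4⟩, h5, h6, h7⟩, h8, h9, h10, h11⟩ := h
      rw [Finset.sum_range_succ, harm, Finset.sum_range_succ, ← harm]
      simp [Ready, Base, Store.setNat, Store.setReal, Test.toNat, Test.Holds, NExpr.eval,
        RExpr.eval, h1, h2, h3, h4, h5, h6, h7, h8, h9, h10, h11, inputForm, sq])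
    (s := (s.setNat 10 0 0).setReal 5 0 0) (by
      obtain ⟨⟨h1, h2, h3, h4⟩, h5, h6, h7⟩ := hs
      simp [Ready, Base, Store.setNat, Store.setReal, harm, h1, h2, h3, h4, h5, h6, h7, hc])
  obtain ⟨h1, h2, h3, h4, h5⟩ := hs'
  refine ⟨s', ((Runs.setNat 10 (.const 0) (.const 0) s).seq
    ((Runs.setReal 5 (.const 0) (.const 0) _).seq (by simpa [NExpr.eval, RExpr.eval] using
      hr))).mono (by omega), h1, h3, ?_, h5⟩
  rw [h4, DiskFamily.crossing, Finset.card_filter, Finset.sum_range]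
  simp [inputForm, DiskFamily.form, DiskFamily.input]

end RealRAM

/-! ### Median lines with few crossing disks are separators -/

theorem DiskFamily.countP_form {m : ℕ} (D : DiskFamily m) (j : ℕ) (P : ℝ → Prop)
    [DecidablePred P] :
    ((List.range m).map (RealRAM.inputForm D j)).countP (fun x => decide (P x)) =
      (Finset.univ.filter fun i => P (D.form m j i)).card := by
  rw [countP_map_range, Finset.card_filter, Finset.sum_range]
  refine Finset.sum_congr rfl fun i _ => if_congr ?_ rfl rfl
  simp [RealRAM.inputForm, form, input]

theorem DiskFamily.disk_subset_negSide {m : ℕ} (D : DiskFamily m) {a b c : ℝ} {i : Fin m}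
    (h : D.radius ^ 2 * (a ^ 2 + b ^ 2) < (D.form a b i - c) ^ 2) (hc : D.form a b i < c) :
    D.disk i ⊆ negSide a b c := by
  intro x hx
  have hx' : dist x (D.center i) ≤ D.radius := hx
  rw [EuclideanSpace.dist_eq, Fin.sum_univ_two, Real.dist_eq, Real.dist_eq, sq_abs, sq_abs,
    Real.sqrt_le_left D.radius_pos.le] at hx'
  change a * x 0 + b * x 1 < c
  set u := x 0 - D.center i 0 with hu
  set v := x 1 - D.center i 1 with hv
  have e : a * x 0 + b * x 1 = D.form a b i + (a * u + b * v) := by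
    rw [form, hu, hv]; ring
  have h1 : (a * u + b * v) ^ 2 ≤ (a ^ 2 + b ^ 2) * (u ^ 2 + v ^ 2) := by
    nlinarith [sq_nonneg (a * v - b * u)]
  have h2 : (a ^ 2 + b ^ 2) * (u ^ 2 + v ^ 2) ≤ (a ^ 2 + b ^ 2) * D.radius ^ 2 := by gcongr
  have h3 : (a * u + b * v) ^ 2 < (c - D.form a b i) ^ 2 := by nlinarith
  have h4 := lt_of_abs_lt (abs_lt_of_sq_lt_sq h3 (by linarith))
  linarith

theorem DiskFamily.disk_subset_posSide {m : ℕ} (D : DiskFamily m) {a b c : ℝ} {i : Fin m}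
    (h : D.radius ^ 2 * (a ^ 2 + b ^ 2) < (D.form a b i - c) ^ 2) (hc : c < D.form a b i) :
    D.disk i ⊆ posSide a b c := by
  intro x hx
  have := D.disk_subset_negSide (a := -a) (b := -b) (c := -c) (i := i)
    (by simp only [form] at h ⊢; nlinarith) (by simp only [form] at hc ⊢; linarith) hx
  change -a * x 0 + -b * x 1 < -c at this
  change c < a * x 0 + b * x 1
  linarith

/-- Each closed half-plane of a median line has at least half of the centers, and a disk centered
there either crosses or lies completely on that side. The constant is 1300 = 650 · 2, from
`harm_le`. -/
theorem DiskFamily.isSeparator_of_isKth {m : ℕ} (hm : 2 ≤ m) (D : DiskFamily m) {j : ℕ} {c : ℝ}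
    (hc : IsKth ((List.range m).map (RealRAM.inputForm D j)) (m / 2) c)
    (hN : ¬ 650 * m * harm m < ((D.crossing m j c).card : ℝ) ^ 2) :
    D.IsSeparator (√1300) m j c := by
  have hm' : (0 : ℝ) < m := by positivity
  set N := (D.crossing m j c).card with hNdef
  have hNle : (N : ℝ) ≤ √1300 * √((m : ℝ) * Real.logb 2 m) := by
    rw [← Real.sqrt_mul (by norm_num)]
    apply Real.le_sqrt_of_sq_le
    have h1 := harm_le hm
    have h2 : 650 * m * harm m ≤ 650 * m * (2 * Real.logb 2 m) := by gcongr
    linarith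
  have hlow : 2 * (Finset.univ.filter fun i => D.form m j i < c).card ≤ m := by
    have := hc.1
    rw [D.countP_form j fun x => x < c] at this
    omega
  have hhigh : m ≤ 2 * (Finset.univ.filter fun i => D.form m j i ≤ c).card := by
    have := hc.2
    rw [D.countP_form j fun x => x ≤ c] at this
    omega
  have hon : ∀ i, D.form m j i = c → i ∈ D.crossing m j c := by
    intro i hi
    have := D.radius_pos
    simp only [crossing, Finset.mem_filter, Finset.mem_univ, true_and, hi, sub_self, not_lt]
    rw [zero_pow two_ne_zero]
    positivity
  have hcross : ∀ i, i ∉ D.crossing m j c →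
      D.radius ^ 2 * ((m : ℝ) ^ 2 + (j : ℝ) ^ 2) < (D.form m j i - c) ^ 2 := by
    intro i hi
    simpa [crossing] using hi
  have hneg : (Finset.univ.filter fun i => D.form m j i ≤ c).card ≤
      {i | D.disk i ⊆ negSide m j c}.ncard + N := by
    classical
    rw [← Set.ncard_coe_finset, hNdef, ← Set.ncard_coe_finset (D.crossing m j c)]
    refine (Set.ncard_le_ncard ?_ (Set.toFinite _)).trans (Set.ncard_union_le _ _)
    intro i hi
    by_cases hx : i ∈ D.crossing m j c
    · exact Or.inr hx
    · refine Or.inl (D.disk_subset_negSide (hcross i hx) (lt_of_le_of_ne ?_ fun h => hx (hon i h)))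
      simpa using hi
  have hpos : m ≤ (Finset.univ.filter fun i => D.form m j i < c).card +
      {i | D.disk i ⊆ posSide m j c}.ncard + N := by
    classical
    rw [← Set.ncard_coe_finset, hNdef, ← Set.ncard_coe_finset (D.crossing m j c)]
    have huniv : m = (Set.univ : Set (Fin m)).ncard := by simp
    conv_lhs => rw [huniv]
    refine (Set.ncard_le_ncard (t := (_ ∪ _) ∪ _) ?_ (Set.toFinite _)).trans
      ((Set.ncard_union_le _ _).trans (Nat.add_le_add_right (Set.ncard_union_le _ _) _))
    intro i _
    by_cases hx : i ∈ D.crossing m j c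
    · exact Or.inr hx
    · rcases lt_trichotomy (D.form m j i) c with h | h | h
      · exact Or.inl (Or.inl (by simpa using h))
      · exact absurd (hon i h) hx
      · exact Or.inl (Or.inr (D.disk_subset_posSide (hcross i hx) h))
  have h1 : (m : ℝ) ≤ 2 * ({i | D.disk i ⊆ negSide m j c}.ncard + N) := by
    exact_mod_cast hhigh.trans (by omega)
  have h2 : (m : ℝ) ≤ 2 * ({i | D.disk i ⊆ posSide m j c}.ncard + N) := by
    have : m ≤ 2 * ({i | D.disk i ⊆ posSide m j c}.ncard + N) := by omega
    exact_mod_cast this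
  exact ⟨Or.inl hm'.ne', by linarith, by linarith⟩

open Classical in
/-- The directions with a median line that crosses many disks. -/
noncomputable def DiskFamily.badDirections {m : ℕ} (D : DiskFamily m) : Finset ℕ :=
  (Finset.range (m + 1)).filter fun j =>
    ∃ c, IsKth ((List.range m).map (RealRAM.inputForm D j)) (m / 2) c ∧
      650 * m * harm m < ((D.crossing m j c).card : ℝ) ^ 2

theorem DiskFamily.mem_badDirections {m : ℕ} (D : DiskFamily m) {j : ℕ} :
    j ∈ D.badDirections ↔ j ∈ Finset.range (m + 1) ∧
      ∃ c, IsKth ((List.range m).map (RealRAM.inputForm D j)) (m / 2) c ∧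
        650 * m * harm m < ((D.crossing m j c).card : ℝ) ^ 2 := by
  simp only [badDirections, Finset.mem_filter]

theorem DiskFamily.two_mul_card_badDirections_le {m : ℕ} (hm : 0 < m) (D : DiskFamily m) :
    2 * D.badDirections.card ≤ m := by
  have h : ∀ j, ∃ c, j ∈ D.badDirections →
      650 * m * harm m < ((D.crossing m j c).card : ℝ) ^ 2 := by
    intro j
    by_cases hj : j ∈ D.badDirections
    · obtain ⟨c, hc⟩ := (D.mem_badDirections.1 hj).2
      exact ⟨c, fun _ => hc.2⟩
    · exact ⟨0, fun h => absurd h hj⟩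
  choose c hc using h
  refine D.two_mul_card_le hm _ (fun j hj => ?_) c hc
  exact Nat.lt_succ_iff.1 (Finset.mem_range.1 (D.mem_badDirections.1 hj).1)

theorem DiskFamily.exists_isKth_form {m : ℕ} (hm : 0 < m) (D : DiskFamily m) (j : ℕ) :
    ∃ c, IsKth ((List.range m).map (RealRAM.inputForm D j)) (m / 2) c :=
  exists_isKth _ (by simpa using Nat.div_lt_self hm (by norm_num))

theorem DiskFamily.not_lt_of_notMem_badDirections {m : ℕ} (D : DiskFamily m) {j : ℕ}
    (hj : j ≤ m) (h : j ∉ D.badDirections) {c : ℝ}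
    (hc : IsKth ((List.range m).map (RealRAM.inputForm D j)) (m / 2) c) :
    ¬ 650 * m * harm m < ((D.crossing m j c).card : ℝ) ^ 2 := fun hlt =>
  h (D.mem_badDirections.2 ⟨Finset.mem_range.2 (Nat.lt_succ_iff.2 hj), c, hc, hlt⟩)

theorem DiskFamily.exists_isSeparator {m : ℕ} (hm : 2 ≤ m) (D : DiskFamily m) :
    ∃ a b c : ℝ, D.IsSeparator (√1300) a b c := by
  have hcard := D.two_mul_card_badDirections_le (by omega)
  obtain ⟨j, hj, hbad⟩ : ∃ j ∈ Finset.range (m + 1), j ∉ D.badDirections := by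
    refine Finset.exists_mem_notMem_of_card_lt_card ?_
    rw [Finset.card_range]
    omega
  obtain ⟨c, hc⟩ := D.exists_isKth_form (by omega) j
  exact ⟨m, j, c, D.isSeparator_of_isKth hm hc (D.not_lt_of_notMem_badDirections
    (Nat.lt_succ_iff.1 (Finset.mem_range.1 hj)) hbad hc)⟩

/-! ### Expected cost of the whole program -/

namespace RealRAM

/-- One attempt, given a bound `X` for starting afresh. Rejection happens only in bad directions,
which alone are charged `X`; acceptance itself proves that the output is a separator. -/
theorem cost_attempt_le {m : ℕ} (hm : 2 ≤ m) (D : DiskFamily m) {n X z : ℕ} (hz : z ≤ m)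
    (hX : ∀ s, Base D s → s.nat 1 0 = 0 → Config.cost
      (fun s => D.IsSeparator (√1300) (s.real 3 0) (s.real 3 1) (s.real 3 2)) n ⟨[separate], s⟩ ≤ X)
    {s : Store} (hs : Base D s) (h0 : s.nat 1 0 = 0) (h3 : s.nat 3 0 = z) :
    Config.cost (fun s => D.IsSeparator (√1300) (s.real 3 0) (s.real 3 1) (s.real 3 2)) n
      ⟨.seq (.seq setDirection fill) (.seq select (.seq countCrossing accept)) :: [separate], s⟩ ≤
        (200 * m + if z ∈ D.badDirections then X else 0 : ℕ) := by
  set Q : Store → Prop := fun s => D.IsSeparator (√1300) (s.real 3 0) (s.real 3 1) (s.real 3 2)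
  set Y : ℕ := if z ∈ D.badDirections then X else 0 with hY
  obtain ⟨t, ht⟩ := D.exists_isKth_form (by omega) z
  have hdir := (Runs.setReal 3 (.const 0) (.ofNat (nv 0)) s).seq
    (Runs.setReal 3 (.const 1) (.ofNat (nv 3)) _)
  set s₀ := (s.setReal 3 ((NExpr.const 0).eval s) ((RExpr.ofNat (nv 0)).eval s)) with hs₀
  set s₁ := s₀.setReal 3 ((NExpr.const 1).eval s₀) ((RExpr.ofNat (nv 3)).eval s₀) with hs₁
  have hready : Ready D z s₁ := by
    obtain ⟨h1, h2, h3', h4⟩ := hs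
    simp [hs₁, hs₀, Ready, Base, Store.setReal, NExpr.eval, RExpr.eval, h1, h2, h3', h4, h0, h3]
  obtain ⟨s₂, r₂, b₂, hn₂, hk₂, hA₂⟩ := runs_fill D z hready
  have hitems : items s₂ = (List.range m).map (inputForm D z) := by
    rw [items, hn₂]
    exact List.map_congr_left fun q hq => hA₂ q (List.mem_range.1 hq)
  have hsearch : Searching D z t s₂ := by
    refine ⟨b₂, fun _ => ?_, fun h => by omega⟩
    rw [hitems, hk₂]
    exact ht
  have hfinal : ∀ s, Ready D z s → s.real 3 2 = t →
      Config.cost Q n ⟨.seq countCrossing accept :: [separate], s⟩ ≤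
        (7 * m + 11 + Y : ℕ) := by
    intro s b hst
    obtain ⟨s₃, r₃, b₃, hc₃, hN₃, hH₃⟩ := runs_countCrossing D z b
    have r₄ := r₃.seq (Runs.incIf (.not (.realLt (.mul (.mul (.const 650) (.ofNat (nv 0))) (rv 5 0))
      (.mul (.ofNat (nv 10)) (.ofNat (nv 10))))) 1 s₃)
    refine (r₄ Q n _).trans ?_
    rw [hst] at hc₃ hN₃
    obtain ⟨⟨h1, h2, h3', h4⟩, h5, h6, h7⟩ := b₃
    by_cases hlt : 650 * m * harm m < ((D.crossing m z t).card : ℝ) ^ 2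
    · have hbad : z ∈ D.badDirections := by
        by_contra h
        exact D.not_lt_of_notMem_badDirections hz h ht hlt
      have := hX (s₃.setNat 1 0 (s₃.nat 1 0 + Test.toNat (.not (.realLt
        (.mul (.mul (.const 650) (.ofNat (nv 0))) (rv 5 0))
        (.mul (.ofNat (nv 10)) (.ofNat (nv 10))))) s₃))
        (by simp [Base, Store.setNat, h1, h2, h3', h4])
        (by
          rw [sq] at hlt
          simp [Store.setNat, Test.toNat, Test.Holds, NExpr.eval, RExpr.eval, h1, h5, hN₃, hH₃,
            hlt])
      refine (add_le_add le_rfl this).trans ?_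
      rw [hY, if_pos hbad]
      norm_cast
      omega
    · have hexit := Runs.while_neg (b := .natLt (nv 1) (.const 1))
        (p := .seq (.rand 3 (.const 0) (nv 0))
          (.seq (.seq setDirection fill) (.seq select (.seq countCrossing accept))))
        (s := s₃.setNat 1 0 (s₃.nat 1 0 + Test.toNat (.not (.realLt
          (.mul (.mul (.const 650) (.ofNat (nv 0))) (rv 5 0))
          (.mul (.ofNat (nv 10)) (.ofNat (nv 10))))) s₃)) (by
          rw [sq] at hlt
          simp [Store.setNat, Test.toNat, Test.Holds, NExpr.eval, RExpr.eval, h1, h5, hN₃, hH₃,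
            hlt])
      have hnil : Config.cost Q n ⟨[], s₃.setNat 1 0 (s₃.nat 1 0 + Test.toNat (.not (.realLt
          (.mul (.mul (.const 650) (.ofNat (nv 0))) (rv 5 0))
          (.mul (.ofNat (nv 10)) (.ofNat (nv 10))))) s₃)⟩ ≤ 0 := by
        apply cost_nil_le
        change D.IsSeparator (√1300) (s₃.real 3 0) (s₃.real 3 1) (s₃.real 3 2)
        rw [h6, h7, hc₃]
        exact D.isSeparator_of_isKth hm ht hlt
      refine (add_le_add le_rfl ((hexit Q n []).trans (add_le_add le_rfl hnil))).trans ?_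
      norm_cast
      omega
  have hsel := cost_select_le D z t Q _ _ n hfinal s₂ hsearch
  have htail := (cost_seq_le Q n select (.seq countCrossing accept) [separate] s₂).trans
    (add_le_add le_rfl hsel)
  have hall := (cost_seq_le Q n _ _ _ s).trans (add_le_add le_rfl
    ((hdir.seq r₂ Q n _).trans (add_le_add le_rfl htail)))
  refine hall.trans ?_
  rw [hn₂]
  norm_cast
  omega

/-- At most `m / 2` of the `m + 1` directions restart, so `T = 410 m` has to satisfy `3 + 200 m + T
/ 2 ≤ T`, where 3 counts the loop test, the sequencing and the draw. -/
theorem cost_separate_le {m : ℕ} (hm : 2 ≤ m) (D : DiskFamily m) (n : ℕ) {s : Store}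
    (hs : Base D s) (h0 : s.nat 1 0 = 0) :
    Config.cost (fun s => D.IsSeparator (√1300) (s.real 3 0) (s.real 3 1) (s.real 3 2)) n
      ⟨[separate], s⟩ ≤ (410 * m : ℕ) := by
  induction n generalizing s with
  | zero => simp [Config.cost]
  | succ n ih =>
    rw [separate, cost_succ_while (by simp [Test.Holds, NExpr.eval, h0]), ← separate]
    have hrand := cost_rand_le (Q := fun s => D.IsSeparator (√1300) (s.real 3 0) (s.real 3 1)
      (s.real 3 2)) (n := n) (a := 3) (i := .const 0) (e := nv 0) (k := m) (s := s)
      (κ := .seq (.seq setDirection fill) (.seq select (.seq countCrossing accept)) :: [separate])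
      (by simp [NExpr.eval, hs.1])
      (fun z => 200 * m + if z ∈ D.badDirections then 410 * m else 0) (200 * m + 205 * m)
      (fun z hz => by
        obtain ⟨h1, h2, h3, h4⟩ := hs
        exact cost_attempt_le hm D hz (fun s a b => ih a b)
          (by simp [Base, Store.setNat, h1, h2, h3, h4]) (by simp [Store.setNat, h0])
          (by simp [Store.setNat, NExpr.eval]))
      (by
        have hcard := D.two_mul_card_badDirections_le (by omega)
        have hle : (∑ z ∈ Finset.range (m + 1), if z ∈ D.badDirections then 410 * m else 0) ≤
            D.badDirections.card * (410 * m) := by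
          rw [← Finset.sum_filter, Finset.sum_const, smul_eq_mul]
          gcongr
          exact fun z hz => (Finset.mem_filter.1 hz).2
        rw [Finset.sum_add_distrib, Finset.sum_const, Finset.card_range, smul_eq_mul]
        nlinarith)
    refine (add_le_add le_rfl ((cost_seq_le _ n _ _ _ _).trans (add_le_add le_rfl hrand))).trans ?_
    norm_cast
    omega

end RealRAM

theorem mainTheorem8 :
    ∃ κ : ℝ, 0 ≤ κ ∧
      (∀ (m : ℕ), 2 ≤ m → ∀ D : DiskFamily m, ∃ a b c : ℝ, D.IsSeparator κ a b c) ∧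
      ∃ (P : RealRAM.Program) (C : ℕ),
        ∀ (m : ℕ), 2 ≤ m → ∀ D : DiskFamily m,
          (RealRAM.Config.mk [P] D.input).AlwaysReturns
              (fun s => D.IsSeparator κ (s.real 3 0) (s.real 3 1) (s.real 3 2)) ∧
          (RealRAM.Config.mk [P] D.input).expectedTime ≤ (C : ENNReal) * (m : ENNReal) := by
  refine ⟨√1300, Real.sqrt_nonneg _, fun m hm D => D.exists_isSeparator hm,
    RealRAM.separate, 410, fun m hm D => ?_⟩
  have h := fun n => RealRAM.cost_separate_le hm D n (s := D.input)
    (by simp [RealRAM.Base, DiskFamily.input]) (by simp [DiskFamily.input])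
  refine ⟨RealRAM.alwaysReturns_of_cost_le h, ?_⟩
  exact_mod_cast RealRAM.expectedTime_le h
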